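/- Let $L>0$, let $I\subseteq\mathbb R$ be an interval with more than one point, and let $q(x,t)$, $x\in\mathbb R$, $t\in I$, be a classical solution of $\mathrm i q_t+q_{xx}+2|q|^2q=0$ with $q(x+L,t)=q(x,t)$ and with $q,q_x,q_{xx}$ continuous on $\mathbb R\times I$ (time derivatives are one-sided at end points of $I$). Put $$\sigma_3=\begin{pmatrix}1&0\\0&-1\end{pmatrix},\quad Q=\begin{pmatrix}0&q\\-q^*&0\end{pmatrix},\quad U=\frac1{\sqrt2}\begin{pmatrix}1&1\\-\mathrm i&\mathrm i\end{pmatrix},\quad \mathcal A=2\mathrm i\sigma_3\partial_x^2+2\mathrm iQ\sigma_3\partial_x-\mathrm i(Q^2-Q_x)\sigma_3,\quad \tilde{\mathcal A}=U\mathcal AU^{-1}.$$ For fixed $t$ let $Y(x,t,z)$ be the matrix solution of $v_x=(-\mathrm iz\sigma_3+Q)v$ with $Y(0,t,z)=\mathbb I$, let $\tilde Y=UYU^{-1}=(\tilde y_{ij})$, and let $\Delta=\frac12\operatorname{tr}Y(L,t,z)$. The Lax spectrum $\Sigma$ is the set of $z$ for which $v_x=(-\mathrm iz\sigma_3+Q)v$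 has a bounded nontrivial solution on $\mathbb R$, and $\Sigma^o=\Sigma\setminus\{\Delta^2=1\}$. The Dirichlet spectrum at time $t$ is the set of $\mu$ for which the system with $z=\mu$ has a nontrivial solution on $[0,L]$ with $v_1+v_2=0$ at $x=0$ and $x=L$. Fix $t_0\in I$ and let $\rho(z)$ be a root of $\rho^2-2\Delta(z)\rho+1=0$, with $\Delta$ and $\Sigma$ taken at $t_0$, such that $|\rho(z)|<1$ for $z\notin\Sigma$; on $\Sigma$ either root may be chosen. Let $\psi^\pm(x,t,z)$ be the solution of $\psi_x=U(-\mathrm iz\sigma_3+Q)U^{-1}\psi$ with $\psi^\pm(x+L,t,z)=\rho(z)^{\pm1}\psi^\pm(x,t,z)$ and $\psi_1^\pm(0,t,z)=1$, wherever it exists and is unique. Let $$\alpha^\pm(t,z)=z(q-q^*)+\tfrac{\mathrm i}2(q_x+q_x^*)+\Big(2z^2-\mathrm iz(q^*+q)-|q|^2+\tfrac12q_x-\tfrac12q_x^*\Big)\psi_2^\pm(0,t,z),$$ where $q,q_x$ are evaluated at $(0,t)$. Then the following hold. 1. For every $t\in I$ and every $z$ outside the Dirichlet spectrum at time $t$,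 both $\psi^\pm(\cdot,t,z)$ exist and are unique. At every $(t,z)$ where $\psi^+$ (respectively $\psi^-$) exists and is unique, for all $x$, $$\psi^\pm_t(x,t,z)+\alpha^\pm(t,z)\psi^\pm(x,t,z)=\tilde{\mathcal A}\psi^\pm(x,t,z).$$ 2. For each fixed $t\in I$, as $z\to\infty$ nontangentially in $\mathbb C^\pm$, that is, uniformly in each closed sector $|\operatorname{Im}z|\ge\delta|z|$ with $\delta>0$, the points $z$ eventually lie outside the Dirichlet spectrum and $$\alpha^\pm=\pm2\mathrm iz^2+O(1/z)\ \ (z\in\mathbb C^+),\qquad \alpha^\pm=\mp2\mathrm iz^2+O(1/z)\ \ (z\in\mathbb C^-).$$ 3. Let $\mu_n:I\to\mathbb C$ be continuous with $\mu_n(t)$ in the Dirichlet spectrum at time $t$ for every $t\in I$. Define $\nu_n(t)=-\operatorname{sgn}\log|\tilde y_{22}(L,t,\mu_n(t))|$ (with $\operatorname{sgn}0=0$) if $\mu_n(t)\notin\Sigma^o$. If $\mu_n(t)\in\Sigma^o$, let $\nu_n(t)=1$ when $\tilde y_{22}(L,t,\mu_n(t))=\rho(\mu_n(t))$ and $\nu_n(t)=-1$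 otherwise. Let $t\in I$ be such that $\mu_n(t)$ is a simple zero of $\tilde y_{12}(L,t,\cdot)$. If $\nu_n(t)=1$, then $\mu_n$ is differentiable at $t$ and $\alpha^+(t,\cdot)$ has a simple pole at $\mu_n(t)$ with residue $-\mu_{n,t}(t)$. If $\nu_n(t)=-1$, the same holds for $\alpha^-(t,\cdot)$. Here "simple pole" means a pole of order exactly one if $\mu_{n,t}(t)\ne0$ and a removable singularity if $\mu_{n,t}(t)=0$. If $\mu_n(t)\in\Sigma$, where $\rho$ and hence $\alpha^\pm$ may jump across a band, the assertion is that there is one function $G$, meromorphic near $\mu_n(t)$, with this simple pole and residue, such that on every set $D$ along which $\rho$ is continuous at $\mu_n(t)$ the function $\alpha^\pm(t,\cdot)$ agrees with $G$ at all points of $D\setminus\{\mu_n(t)\}$ near $\mu_n(t)$. -/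

import Mathlib

open Filter Topology Asymptotics

namespace ZS

noncomputable section

/-- The Pauli matrix `σ₃ = diag(1,-1)`. -/
def sigma3 : Matrix (Fin 2) (Fin 2) ℂ := !![1, 0; 0, -1]

/-- The potential matrix with entries `a` and `-conj a` off the diagonal: `Q(x) = offDiag (u x)` and
`Q_x(x) = offDiag (u' x)`. -/
def offDiag (a : ℂ) : Matrix (Fin 2) (Fin 2) ℂ := !![0, a; -(starRingEnd ℂ) a, 0]

/-- The matrix `U` of the similarity transformation. -/
def U : Matrix (Fin 2) (Fin 2) ℂ :=
  ((Real.sqrt 2 : ℝ) : ℂ)⁻¹ • !![1, 1; -Complex.I, Complex.I]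

/-- The coefficient matrix `-i z σ₃ + Q(x)` of the Zakharov–Shabat system with potential `u`.
The eigenvalue equation `i σ₃ (∂ₓ - Q) v = z v` is the system `v_x = X v`. -/
def X (u : ℝ → ℂ) (z : ℂ) (x : ℝ) : Matrix (Fin 2) (Fin 2) ℂ :=
  (-Complex.I * z) • sigma3 + offDiag (u x)

/-- `v` is a (classical) solution on the whole line of the Zakharov–Shabat system. As `u` is
continuous this is the same as being a weak (locally `H¹`) solution. -/
def IsSolution (u : ℝ → ℂ) (z : ℂ) (v : ℝ → Fin 2 → ℂ) : Prop :=
  ∀ x, HasDerivAt v ((X u z x).mulVec (v x)) x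

/-- `v` is a solution on the whole line of the modified system `v_x = U X U⁻¹ v`. -/
def IsModifiedSolution (u : ℝ → ℂ) (z : ℂ) (v : ℝ → Fin 2 → ℂ) : Prop :=
  ∀ x, HasDerivAt v ((U * X u z x * U⁻¹).mulVec (v x)) x

/-- `Y` is the matrix solution of the Zakharov–Shabat system normalized by `Y(0) = 1`. -/
def IsPrincipalSolution (u : ℝ → ℂ) (z : ℂ) (Y : ℝ → Matrix (Fin 2) (Fin 2) ℂ) : Prop :=
  Y 0 = 1 ∧ ∀ x i j, HasDerivAt (fun y => Y y i j) ((X u z x * Y x) i j) x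

open Classical in
/-- The principal matrix solution `Y(x,z)` (it exists and is unique for every continuous `u`). -/
def Y (u : ℝ → ℂ) (z : ℂ) : ℝ → Matrix (Fin 2) (Fin 2) ℂ :=
  if h : ∃ Y, IsPrincipalSolution u z Y then h.choose else 0

/-- The modified principal solution `U Y U⁻¹`. -/
def Yt (u : ℝ → ℂ) (z : ℂ) (x : ℝ) : Matrix (Fin 2) (Fin 2) ℂ := U * Y u z x * U⁻¹

/-- The Floquet discriminant: half the trace of the monodromy matrix `Y(L,z)`. -/
def Delta (u : ℝ → ℂ) (L : ℝ) (z : ℂ) : ℂ := (1 / 2) * (Y u z L).trace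

/-- The Lax spectrum: those `z` for which there is a bounded nontrivial solution. -/
def laxSpectrum (u : ℝ → ℂ) : Set ℂ :=
  {z | ∃ v, IsSolution u z v ∧ v ≠ 0 ∧ ∃ C : ℝ, ∀ x, ‖v x‖ ≤ C}

/-- The main spectrum: the zeros of `Δ² - 1`. -/
def mainSpectrum (u : ℝ → ℂ) (L : ℝ) : Set ℂ := {z | Delta u L z ^ 2 - 1 = 0}

/-- The Dirichlet spectrum with base point `0`: those `μ` for which the system has a nontrivial
solution on `[0,L]` with `v₁ + v₂ = 0` at both ends. -/
def dirichletSpectrum (u : ℝ → ℂ) (L : ℝ) : Set ℂ :=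
  {μ | ∃ v : ℝ → Fin 2 → ℂ,
    (∀ x ∈ Set.Icc 0 L, HasDerivWithinAt v ((X u μ x).mulVec (v x)) (Set.Icc 0 L) x) ∧
    (∃ x ∈ Set.Icc 0 L, v x ≠ 0) ∧ v 0 0 + v 0 1 = 0 ∧ v L 0 + v L 1 = 0}

/-- `ρ` is the Floquet multiplier: for every `z` a root of `ρ² - 2 Δ(z) ρ + 1 = 0`, and the root of
modulus less than one off the Lax spectrum. On the Lax spectrum, where the two roots are boundary
values of this function from the two sides of a band, any choice between them is allowed. -/
def IsFloquetMultiplier (u : ℝ → ℂ) (L : ℝ) (ρ : ℂ → ℂ) : Prop :=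
  (∀ z, ρ z ^ 2 - 2 * Delta u L z * ρ z + 1 = 0) ∧ ∀ z, z ∉ laxSpectrum u → ‖ρ z‖ < 1

/-- `ψ` is a Bloch–Floquet solution of the modified system with multiplier `m`, normalized by
`ψ₁(0) = 1`. -/
def IsBlochFloquet (u : ℝ → ℂ) (L : ℝ) (m z : ℂ) (ψ : ℝ → Fin 2 → ℂ) : Prop :=
  IsModifiedSolution u z ψ ∧ (∀ x, ψ (x + L) = m • ψ x) ∧ ψ 0 0 = 1

/-- The normalized Bloch–Floquet solution with multiplier `m` is uniquely determined. -/
def BFDefined (u : ℝ → ℂ) (L : ℝ) (m z : ℂ) : Prop := ∃! ψ, IsBlochFloquet u L m z ψ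

open Classical in
/-- The normalized Bloch–Floquet solution with multiplier `m`, wherever it is uniquely determined
(and `0` elsewhere); `ψ⁺` and `ψ⁻` are the cases `m = ρ(z)` and `m = ρ(z)⁻¹`. -/
def psi (u : ℝ → ℂ) (L : ℝ) (m z : ℂ) : ℝ → Fin 2 → ℂ :=
  if h : BFDefined u L m z then h.choose else 0

/-- The operator `A = 2 i σ₃ ∂ₓ² + 2 i Q σ₃ ∂ₓ - i (Q² - Q_x) σ₃`. -/
def opA (u : ℝ → ℂ) (f : ℝ → Fin 2 → ℂ) (x : ℝ) : Fin 2 → ℂ :=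
  ((2 * Complex.I) • sigma3).mulVec (deriv (deriv f) x)
    + ((2 * Complex.I) • (offDiag (u x) * sigma3)).mulVec (deriv f x)
    - (Complex.I • ((offDiag (u x) ^ 2 - offDiag (deriv u x)) * sigma3)).mulVec (f x)

/-- The operator `U A U⁻¹`. -/
def opAt (u : ℝ → ℂ) (f : ℝ → Fin 2 → ℂ) (x : ℝ) : Fin 2 → ℂ :=
  U.mulVec (opA u (fun y => U⁻¹.mulVec (f y)) x)

/-- The function `α` attached to the Bloch–Floquet solution with multiplier `m`; `α⁺` and `α⁻` are
the cases `m = ρ(z)` and `m = ρ(z)⁻¹`. -/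
def alpha (u : ℝ → ℂ) (L : ℝ) (m z : ℂ) : ℂ :=
  z * (u 0 - (starRingEnd ℂ) (u 0))
    + Complex.I / 2 * (deriv u 0 + (starRingEnd ℂ) (deriv u 0))
    + (2 * z ^ 2 - Complex.I * z * ((starRingEnd ℂ) (u 0) + u 0) - (‖u 0‖ : ℂ) ^ 2
        + (1 / 2) * deriv u 0 - (1 / 2) * (starRingEnd ℂ) (deriv u 0)) * psi u L m z 0 1

open Classical in
/-- The sign `ν` attached to a Dirichlet eigenvalue `μ`. -/
def nu (u : ℝ → ℂ) (L : ℝ) (ρ : ℂ → ℂ) (μ : ℂ) : ℝ :=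
  if μ ∈ laxSpectrum u \ mainSpectrum u L then
    (if Yt u μ L 1 1 = ρ μ then 1 else -1)
  else -Real.sign (Real.log ‖Yt u μ L 1 1‖)

/-- `q(x,t)` is a classical solution, `L`-periodic in `x`, of the focusing nonlinear Schrödinger
equation `i q_t + q_xx + 2 |q|² q = 0` on the time interval `I`, with `q`, `q_x`, `q_xx` (hence also
`q_t`) continuous on `ℝ × I`; time derivatives are one-sided at an end point of `I`. -/
structure IsPeriodicNLSSolution (L : ℝ) (I : Set ℝ) (q : ℝ → ℝ → ℂ) : Prop where
  periodic : ∀ t ∈ I, ∀ x, q (x + L) t = q x t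
  contDiff : ∀ t ∈ I, ContDiff ℝ 2 (fun x => q x t)
  continuous : ContinuousOn (fun p : ℝ × ℝ => q p.1 p.2) (Set.univ ×ˢ I)
  continuous_x : ContinuousOn (fun p : ℝ × ℝ => deriv (fun x => q x p.2) p.1) (Set.univ ×ˢ I)
  continuous_xx :
    ContinuousOn (fun p : ℝ × ℝ => deriv (deriv (fun x => q x p.2)) p.1) (Set.univ ×ˢ I)
  differentiable_t : ∀ x, ∀ t ∈ I, DifferentiableWithinAt ℝ (fun s => q x s) I t
  nls : ∀ x, ∀ t ∈ I, Complex.I * derivWithin (fun s => q x s) I t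
    + deriv (deriv (fun y => q y t)) x + 2 * (‖q x t‖ : ℂ) ^ 2 * q x t = 0

/-- `F` has a pole of order at most one at `μ` with residue `r`; it is a genuine simple pole as
soon as `r ≠ 0`. -/
def HasSimplePole (F : ℂ → ℂ) (μ r : ℂ) : Prop :=
  MeromorphicAt F μ ∧ Tendsto (fun z => (z - μ) * F z) (𝓝[≠] μ) (𝓝 r) ∧
    (r ≠ 0 → meromorphicOrderAt F μ = -1)

/-- `F` has a simple pole at `μ` with residue `r`, in the following sense if `μ` lies on the Lax
spectrum `S`: there `F`, which depends on `ρ`, jumps across the band through `μ`, and the function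
with the simple pole is the continuation of `F` from any region from within which `ρ` is continuous
at `μ`. -/
def HasSimplePoleSided (S : Set ℂ) (ρ F : ℂ → ℂ) (μ r : ℂ) : Prop :=
  (μ ∉ S → HasSimplePole F μ r) ∧
  (μ ∈ S → ∃ G : ℂ → ℂ, HasSimplePole G μ r ∧
    ∀ D : Set ℂ, ContinuousWithinAt ρ D μ → ∀ᶠ z in 𝓝[D \ {μ}] μ, F z = G z)

/-- The closed sector `Im z ≥ δ |z|`. -/
def upperSector (δ : ℝ) : Set ℂ := {z | δ * ‖z‖ ≤ z.im}

/-- The closed sector `Im z ≤ -δ |z|`. -/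
def lowerSector (δ : ℝ) : Set ℂ := {z | z.im ≤ -(δ * ‖z‖)}

end

end ZS

/-! Everything reduces to linear algebra of the monodromy matrix `M(z,t) = Yt … L` relative to the
vector `(0,1)`. A normalized Bloch–Floquet solution is an eigenvector `(1,w)` of `M`; it is unique
exactly when `(0,1)` is not an eigenvector for the same multiplier. The Dirichlet spectrum is the
zero set of `M₁₂`, where `(0,1)` is an eigenvector with eigenvalue `M₂₂`.

Evolution: eliminating `x`-derivatives turns the second Lax operator into a matrix `B`, and zero
curvature shows that `B(x)Y(x) - Y(x)B(0)` solves the equation linearized in time. With periodicity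
this gives `M_t = [B(0), M]` (`hasDerivWithinAt_monodromy`), so `Δ`, the Lax spectrum and the
admissible `ρ` do not depend on time (`Delta_eq`). The eigenvector component `w` then obeys a
Riccati equation, and `α`, the first entry of `B(0)(1,w)`, is exactly what must be subtracted to
preserve `ψ₁(0) = 1` (`hasDerivWithinAt_psi`).

Asymptotics: off a horizontal strip `Im z (|v₁|² - |v₂|²)` is strictly increasing
(`strictMono_energy`). For a Bloch solution its sign is therefore decided by the multiplier, so one
of `v₁/v₂`, `v₂/v₁` stays in the unit disc. That ratio is a periodic solution of a Riccati equation
with large linear coefficient `∓2iz`, and `riccati_periodic_bound` expands it up to `O(z⁻³)`.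
Inserted in `α`, the terms of order `z` and `1` cancel.

Poles: `α = B₁₁ + B₁₂ (m - M₁₁)/M₁₂` has residue `B₁₂ (m - M₁₁)/∂_z M₁₂` at a simple zero of `M₁₂`.
Differentiating `M₁₂(μ(t),t) = 0` gives `-μ_t` as the same expression with `M₂₂` for `m`. The sign
`ν` records which of `ρ`, `ρ⁻¹` equals `M₂₂` (`nu_eq_one_or_neg_one`). -/

namespace ZS

/-! ### Grönwall's inequality and global solvability of linear equations -/

section LinearODE

open MeasureTheory

variable {E : Type*} [NormedAddCommGroup E] [NormedSpace ℝ E]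

/-- A two-sided form of Grönwall's inequality with a crude explicit constant. -/
lemma norm_le_of_norm_deriv_le {f f' : ℝ → E} {δ K ε R : ℝ} (hK : 1 ≤ K) (hε : 0 ≤ ε)
    (hf : ∀ x, HasDerivAt f (f' x) x) (h0 : ‖f 0‖ ≤ δ)
    (bound : ∀ x, |x| ≤ R → ‖f' x‖ ≤ K * ‖f x‖ + ε) {x : ℝ} (hx : |x| ≤ R) :
    ‖f x‖ ≤ (δ + ε) * Real.exp (K * R) := by
  have hR : 0 ≤ R := (abs_nonneg x).trans hx
  have hδ : 0 ≤ δ := (norm_nonneg _).trans h0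
  have key : ∀ g g' : ℝ → E, (∀ x, HasDerivAt g (g' x) x) → ‖g 0‖ ≤ δ →
      (∀ x, |x| ≤ R → ‖g' x‖ ≤ K * ‖g x‖ + ε) → ∀ y, 0 ≤ y → y ≤ R →
      ‖g y‖ ≤ (δ + ε) * Real.exp (K * R) := by
    intro g g' hg hg0 hb y hy hyR
    have h1 := norm_le_gronwallBound_of_norm_deriv_right_le (a := 0) (b := R) (δ := δ) (K := K)
      (ε := ε) (f := g) (f' := g')
      (fun x _ => (hg x).continuousAt.continuousWithinAt)
      (fun x _ => (hg x).hasDerivWithinAt) hg0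
      (fun x hx => hb x (by rw [abs_of_nonneg hx.1]; exact hx.2.le)) y ⟨hy, hyR⟩
    refine h1.trans ?_
    rw [gronwallBound_of_K_ne_0 (by positivity), sub_zero]
    have h2 : Real.exp (K * y) ≤ Real.exp (K * R) := by gcongr
    have h3 : ε / K ≤ ε := div_le_self hε hK
    have h4 : 0 ≤ ε / K := by positivity
    have h5 : 1 ≤ Real.exp (K * y) := Real.one_le_exp (by positivity)
    calc _ ≤ δ * Real.exp (K * R) + ε * Real.exp (K * R) := by
            refine add_le_add (by gcongr) (mul_le_mul h3 (by linarith) (by linarith) hε)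
      _ = _ := by ring
  rcases le_total 0 x with h | h
  · exact key f f' hf h0 bound x h (by rwa [abs_of_nonneg h] at hx)
  · have := key (fun y => f (-y)) (fun y => -f' (-y))
      (fun y => by simpa using! (hf (-y)).scomp y (hasDerivAt_neg y)) (by simpa using h0)
      (fun y hy => by simpa using bound (-y) (by simpa using hy)) (-x) (by linarith)
      (by rwa [abs_of_nonpos h] at hx)
    simpa using this

variable [CompleteSpace E]

/-- Global solvability of the initial value problem for an inhomogeneous linear equation. -/
lemma exists_linear_solution {A : ℝ → E →L[ℝ] E} (hA : Continuous A) {f : ℝ → E}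
    (hf : Continuous f) (c : E) :
    ∃ v : ℝ → E, v 0 = c ∧ ∀ x, HasDerivAt v (A x (v x) + f x) x := by
  -- Picard increments: the solution is the sum of the `g n`, the inhomogeneity and the initial
  -- value entering only through `g 0`.
  obtain ⟨g, hg0, hgs⟩ : ∃ g : ℕ → ℝ → E, (g 0 = fun x => c + ∫ s in (0 : ℝ)..x, f s) ∧
      ∀ n, g (n + 1) = fun x => ∫ s in (0 : ℝ)..x, A s (g n s) :=
    ⟨fun n => Nat.rec (fun x => c + ∫ s in (0 : ℝ)..x, f s)
      (fun _ h x => ∫ s in (0 : ℝ)..x, A s (h s)) n, rfl, fun _ => rfl⟩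
  have g0 : ∀ x, HasDerivAt (g 0) (f x) x := fun x => hg0 ▸
    (intervalIntegral.integral_hasDerivAt_right (hf.intervalIntegrable _ _)
      (hf.stronglyMeasurableAtFilter _ _) hf.continuousAt).const_add c
  have gc : ∀ n, Continuous (g n) := by
    intro n
    induction n with
    | zero => exact continuous_iff_continuousAt.2 fun x => (g0 x).continuousAt
    | succ n ih =>
      have : Continuous fun s => A s (g n s) := hA.clm_apply ih
      rw [hgs]
      exact continuous_iff_continuousAt.2 fun x =>
        (intervalIntegral.integral_hasDerivAt_right (this.intervalIntegrable 0 _)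
          (this.stronglyMeasurableAtFilter _ _) this.continuousAt).continuousAt
  have gs : ∀ n x, HasDerivAt (g (n + 1)) (A x (g n x)) x := by
    intro n x
    have : Continuous fun s => A s (g n s) := hA.clm_apply (gc n)
    rw [hgs]
    exact intervalIntegral.integral_hasDerivAt_right (this.intervalIntegrable 0 _)
      (this.stronglyMeasurableAtFilter _ _) this.continuousAt
  have gz : ∀ n, g (n + 1) 0 = 0 := fun n => by simp [hgs]
  -- Factorial decay on compact sets. It gives convergence of the series and of the series of
  -- derivatives.
  have gb : ∀ R : ℝ, ∃ M K : ℝ, 0 ≤ M ∧ 0 ≤ K ∧ (∀ x, |x| ≤ R → ‖A x‖ ≤ K) ∧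
      ∀ n x, |x| ≤ R → ‖g n x‖ ≤ M * (K * |x|) ^ n / n.factorial := by
    intro R
    have hcpt : IsCompact (Set.Icc (-R) R) := isCompact_Icc
    obtain ⟨K, hK⟩ := hcpt.exists_bound_of_continuousOn hA.continuousOn
    obtain ⟨M, hM⟩ := hcpt.exists_bound_of_continuousOn (gc 0).continuousOn
    refine ⟨max M 0, max K 0, le_max_right _ _, le_max_right _ _,
      fun x hx => (hK x (abs_le.1 hx)).trans (le_max_left _ _), ?_⟩
    intro n
    induction n with
    | zero => intro x hx; simpa using Or.inl (hM x (abs_le.1 hx))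
    | succ n ih =>
      intro x hx
      set M' := max M 0
      set K' := max K 0
      have hM' : 0 ≤ M' := le_max_right _ _
      have hK' : 0 ≤ K' := le_max_right _ _
      have h1 : ‖g (n + 1) x‖ ≤ ∫ s in Set.uIoc 0 x, K' * (M' * K' ^ n / n.factorial) * |s - 0| ^ n := by
        rw [hgs]
        refine (intervalIntegral.norm_integral_le_integral_norm_uIoc).trans ?_
        refine setIntegral_mono_on ?_ ?_ measurableSet_uIoc ?_
        · exact (((hA.clm_apply (gc n)).norm).integrableOn_uIcc).mono_set Set.uIoc_subset_uIcc
        · exact (Continuous.integrableOn_uIcc (by fun_prop)).mono_set Set.uIoc_subset_uIcc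
        · intro s hs
          have hs' : |s| ≤ R := by
            refine le_trans ?_ hx
            have := Set.uIoc_subset_uIcc hs
            simpa using Set.abs_sub_left_of_mem_uIcc this
          calc ‖A s (g n s)‖ ≤ ‖A s‖ * ‖g n s‖ := (A s).le_opNorm _
            _ ≤ K' * (M' * (K' * |s|) ^ n / n.factorial) := by
              gcongr
              · exact (hK s (abs_le.1 hs')).trans (le_max_left _ _)
              · exact ih s hs'
            _ = _ := by rw [sub_zero, mul_pow]; ring
      refine h1.trans (le_of_eq ?_)
      rw [integral_const_mul, integral_pow_abs_sub_uIoc, Nat.factorial_succ, sub_zero]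
      push_cast
      have : (n.factorial : ℝ) ≠ 0 := by positivity
      have : (n : ℝ) + 1 ≠ 0 := by positivity
      field_simp
      ring
  have gsum : ∀ x, Summable fun n => g n x := by
    intro x
    obtain ⟨M, K, hM, hK, -, hb⟩ := gb |x|
    refine Summable.of_norm_bounded ((Real.summable_pow_div_factorial (K * |x|)).mul_left M)
      fun n => ?_
    rw [← mul_div_assoc]
    exact hb n x le_rfl
  refine ⟨fun x => ∑' n, g n x, ?_, fun x => ?_⟩
  · show ∑' n, g n 0 = c
    rw [tsum_eq_single 0]
    · simp [hg0]
    · intro n hn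
      obtain ⟨m, rfl⟩ := Nat.exists_eq_succ_of_ne_zero hn
      exact gz m
  · set R := |x| + 1
    obtain ⟨M, K, hM, hK, hAK, hb⟩ := gb R
    have hR : 0 ≤ R := by positivity
    have hsum : Summable fun n : ℕ => K * (M * ((K * R) ^ n / n.factorial)) :=
      ((Real.summable_pow_div_factorial (K * R)).mul_left M).mul_left K
    have hbd : ∀ n y, y ∈ Set.Ioo (-R) R →
        ‖A y (g n y)‖ ≤ K * (M * ((K * R) ^ n / n.factorial)) := by
      intro n y hy
      have hy' : |y| ≤ R := (abs_lt.2 hy).le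
      have h2 : (K * |y|) ^ n ≤ (K * R) ^ n := by gcongr
      calc ‖A y (g n y)‖ ≤ ‖A y‖ * ‖g n y‖ := (A y).le_opNorm _
        _ ≤ K * (M * (K * |y|) ^ n / n.factorial) := by
          gcongr
          · exact hAK y hy'
          · exact hb n y hy'
        _ ≤ _ := by rw [mul_div_assoc]; gcongr
    have hz : Summable fun n => g (n + 1) 0 := by simp only [gz]; exact summable_zero
    have h0R : (0 : ℝ) ∈ Set.Ioo (-R) R := by
      constructor <;> linarith [abs_nonneg x, show R = |x| + 1 from rfl]
    have hxR : x ∈ Set.Ioo (-R) R := abs_lt.1 (by simp [R])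
    have main : HasDerivAt (fun y => ∑' n, g (n + 1) y) (∑' n, A x (g n x)) x :=
      hasDerivAt_tsum_of_isPreconnected hsum isOpen_Ioo isPreconnected_Ioo
        (fun n y _ => gs n y) hbd h0R hz hxR
    -- The term `g 0` is split off because its derivative is `f`, while `g (n + 1)` has derivative
    -- `A (g n)`.
    have e1 : (fun y => ∑' n, g n y) = (fun y => ∑' n, g (n + 1) y) + g 0 := by
      ext y; exact (gsum y).tsum_eq_zero_add.trans (add_comm _ _)
    have e2 : A x (∑' n, g n x) = ∑' n, A x (g n x) := (A x).map_tsum (gsum x)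
    have h := main.add (g0 x)
    rw [← e2] at h
    change HasDerivAt (fun y => ∑' n, g n y) (A x (∑' n, g n x) + f x) x
    rw [e1]
    exact h

end LinearODE

/-! ### The Zakharov–Shabat system, its principal matrix and conjugation by `U` -/

section Basics

open Matrix

lemma mulVec_hasDerivAt {v : ℝ → Fin 2 → ℂ} {v' : Fin 2 → ℂ} {x : ℝ}
    (A : Matrix (Fin 2) (Fin 2) ℂ) (hv : HasDerivAt v v' x) :
    HasDerivAt (fun y => A *ᵥ v y) (A *ᵥ v') x :=
  (LinearMap.toContinuousLinearMap (A.mulVecLin.restrictScalars ℝ)).hasFDerivAt.comp_hasDerivAt x hv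

lemma X_mulVec (u : ℝ → ℂ) (z : ℂ) (x : ℝ) (v : Fin 2 → ℂ) :
    X u z x *ᵥ v = ![-Complex.I * z * v 0 + u x * v 1,
      -(starRingEnd ℂ) (u x) * v 0 + Complex.I * z * v 1] := by
  ext i; fin_cases i <;> simp [X, sigma3, offDiag, mulVec, dotProduct, Fin.sum_univ_two]

lemma norm_X_mulVec_le (u : ℝ → ℂ) (z : ℂ) (x : ℝ) (v : Fin 2 → ℂ) :
    ‖X u z x *ᵥ v‖ ≤ (‖z‖ + ‖u x‖) * ‖v‖ := by
  rw [X_mulVec, pi_norm_le_iff_of_nonneg (by positivity)]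
  have h0 := norm_le_pi_norm v 0
  have h1 := norm_le_pi_norm v 1
  intro i
  fin_cases i
  · simp only [Fin.zero_eta, cons_val_zero]
    refine (norm_add_le _ _).trans ?_
    simp only [norm_mul, norm_neg, Complex.norm_I, one_mul, add_mul]
    gcongr
  · simp only [Fin.mk_one, cons_val_one]
    refine (norm_add_le _ _).trans ?_
    simp only [norm_mul, norm_neg, Complex.norm_I, one_mul, RCLike.norm_conj, add_mul]
    rw [add_comm]
    gcongr

lemma exists_X_solution {u : ℝ → ℂ} (hu : Continuous u) (z : ℂ) {f : ℝ → Fin 2 → ℂ}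
    (hf : Continuous f) (c : Fin 2 → ℂ) :
    ∃ v : ℝ → Fin 2 → ℂ, v 0 = c ∧ ∀ x, HasDerivAt v (X u z x *ᵥ v x + f x) x := by
  refine exists_linear_solution (A := fun x => LinearMap.toContinuousLinearMap
    ((X u z x).mulVecLin.restrictScalars ℝ)) ?_ hf c
  rw [continuous_clm_apply]
  intro v
  change Continuous fun x => X u z x *ᵥ v
  simp only [X_mulVec]
  refine continuous_pi fun i => ?_
  fin_cases i
  · simp; fun_prop
  · simp; fun_prop

lemma IsSolution.bound {u : ℝ → ℂ} {z : ℂ} {v : ℝ → Fin 2 → ℂ} (hv : IsSolution u z v)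
    {K R : ℝ} (hK : 1 ≤ K) (hb : ∀ x, |x| ≤ R → ‖z‖ + ‖u x‖ ≤ K) {x : ℝ} (hx : |x| ≤ R) :
    ‖v x‖ ≤ ‖v 0‖ * Real.exp (K * R) := by
  have := norm_le_of_norm_deriv_le (ε := 0) hK le_rfl hv le_rfl
    (fun x hx => (norm_X_mulVec_le u z x (v x)).trans
      (by rw [add_zero]; exact mul_le_mul_of_nonneg_right (hb x hx) (norm_nonneg _))) hx
  simpa using this

lemma exists_abs_bound {u : ℝ → ℂ} (hu : Continuous u) (z : ℂ) (R : ℝ) :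
    ∃ K, 1 ≤ K ∧ ∀ x, |x| ≤ R → ‖z‖ + ‖u x‖ ≤ K := by
  obtain ⟨K, hK⟩ := (isCompact_Icc (a := -R) (b := R)).exists_bound_of_continuousOn hu.continuousOn
  refine ⟨1 + ‖z‖ + |K|, by linarith [norm_nonneg z, abs_nonneg K], fun x hx => ?_⟩
  linarith [hK x (abs_le.1 hx), le_abs_self K]

lemma IsSolution.eq_zero {u : ℝ → ℂ} (hu : Continuous u) {z : ℂ} {v : ℝ → Fin 2 → ℂ}
    (hv : IsSolution u z v) (h0 : v 0 = 0) (x : ℝ) : v x = 0 := by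
  obtain ⟨K, hK, hb⟩ := exists_abs_bound hu z |x|
  have := hv.bound hK hb le_rfl
  simpa [h0] using this

lemma IsSolution.sub {u : ℝ → ℂ} {z : ℂ} {v w : ℝ → Fin 2 → ℂ} (hv : IsSolution u z v)
    (hw : IsSolution u z w) : IsSolution u z (v - w) := fun x => by
  have := (hv x).sub (hw x)
  rwa [← mulVec_sub] at this

/-- The columns solve the initial value problems for the standard basis, so for a continuous
potential the default value in `Y` never occurs. -/
lemma isPrincipalSolution_Y {u : ℝ → ℂ} (hu : Continuous u) (z : ℂ) :
    IsPrincipalSolution u z (Y u z) := by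
  have h : ∃ Y, IsPrincipalSolution u z Y := by
    choose v hv0 hv using fun j : Fin 2 => exists_X_solution hu z (continuous_const (y := 0))
      (Pi.single j 1 : Fin 2 → ℂ)
    refine ⟨fun x => Matrix.of fun i j => v j x i, ?_, fun x i j => ?_⟩
    · ext i j
      simp [hv0, Pi.single_apply, one_apply]
    · have := hasDerivAt_pi.1 (hv j x) i
      refine this.congr_deriv ?_
      fin_cases i <;> simp [mul_apply]
  unfold Y
  rw [dif_pos h]
  exact h.choose_spec

lemma Y_zero {u : ℝ → ℂ} (hu : Continuous u) (z : ℂ) : Y u z 0 = 1 := (isPrincipalSolution_Y hu z).1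

lemma isSolution_Y {u : ℝ → ℂ} (hu : Continuous u) (z : ℂ) (c : Fin 2 → ℂ) :
    IsSolution u z (fun x => Y u z x *ᵥ c) := by
  intro x
  rw [hasDerivAt_pi]
  intro i
  have h := fun j => ((isPrincipalSolution_Y hu z).2 x i j).mul_const (c j)
  rw [mulVec_mulVec]
  have := HasDerivAt.fun_sum (u := Finset.univ) fun j _ => h j
  simpa [mulVec, dotProduct] using this

lemma IsSolution.eq_Y {u : ℝ → ℂ} (hu : Continuous u) {z : ℂ} {v : ℝ → Fin 2 → ℂ}
    (hv : IsSolution u z v) (x : ℝ) : v x = Y u z x *ᵥ v 0 := by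
  have := (hv.sub (isSolution_Y hu z (v 0))).eq_zero hu
    (by rw [Pi.sub_apply, Y_zero hu, one_mulVec, sub_self]) x
  exact sub_eq_zero.1 this

/-- Liouville's formula: `X` has trace zero. -/
lemma det_Y {u : ℝ → ℂ} (hu : Continuous u) (z : ℂ) (x : ℝ) : (Y u z x).det = 1 := by
  have h : ∀ y, HasDerivAt (fun y => (Y u z y).det) 0 y := by
    intro y
    have h := (isPrincipalSolution_Y hu z).2 y
    simp only [det_fin_two]
    refine (((h 0 0).mul (h 1 1)).sub ((h 0 1).mul (h 1 0))).congr_deriv ?_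
    simp [X, sigma3, offDiag, mul_apply, Fin.sum_univ_two]
    ring
  have := is_const_of_deriv_eq_zero (fun y => (h y).differentiableAt) (fun y => (h y).deriv) x 0
  simpa [Y_zero hu] using this

lemma sqrt_two_inv_mul : ((Real.sqrt 2 : ℝ) : ℂ)⁻¹ * ((Real.sqrt 2 : ℝ) : ℂ)⁻¹ = 1 / 2 := by
  rw [← mul_inv, ← Complex.ofReal_mul, Real.mul_self_sqrt (by norm_num)]; norm_num

lemma U_inv : U⁻¹ = ((Real.sqrt 2 : ℝ) : ℂ)⁻¹ • !![1, Complex.I; 1, -Complex.I] := by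
  refine Matrix.inv_eq_right_inv ?_
  rw [U, smul_mul_smul_comm, sqrt_two_inv_mul]
  ext i j
  fin_cases i <;> fin_cases j <;> simp <;> ring_nf

lemma U_mul_U_inv : U * U⁻¹ = 1 := by
  rw [U_inv, U, smul_mul_smul_comm, sqrt_two_inv_mul]
  ext i j
  fin_cases i <;> fin_cases j <;> simp <;> ring_nf

lemma U_inv_mul_U : U⁻¹ * U = 1 := mul_eq_one_comm.1 U_mul_U_inv

/-- Conjugation by `U` in coordinates. -/
lemma U_conj (A : Matrix (Fin 2) (Fin 2) ℂ) : U * A * U⁻¹ =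
    !![(A 0 0 + A 0 1 + A 1 0 + A 1 1) / 2, Complex.I * (A 0 0 - A 0 1 + A 1 0 - A 1 1) / 2;
      -Complex.I * (A 0 0 + A 0 1 - A 1 0 - A 1 1) / 2, (A 0 0 - A 0 1 - A 1 0 + A 1 1) / 2] := by
  rw [U_inv, U, smul_mul_assoc, smul_mul_smul_comm, sqrt_two_inv_mul]
  conv_lhs => rw [eta_fin_two A]
  rw [mul_fin_two, mul_fin_two]
  ext i j
  fin_cases i <;> fin_cases j <;> simp <;> ring_nf <;> simp <;>
    ring

lemma Yt_zero {u : ℝ → ℂ} (hu : Continuous u) (z : ℂ) : Yt u z 0 = 1 := by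
  rw [Yt, Y_zero hu, mul_one, U_mul_U_inv]

lemma det_Yt {u : ℝ → ℂ} (hu : Continuous u) (z : ℂ) (x : ℝ) : (Yt u z x).det = 1 := by
  have h : (U * U⁻¹).det = 1 := by rw [U_mul_U_inv, det_one]
  rw [det_mul] at h
  rw [Yt, det_mul, det_mul, det_Y hu, mul_one, h]

lemma trace_Yt (u : ℝ → ℂ) (z : ℂ) (x : ℝ) : (Yt u z x).trace = (Y u z x).trace := by
  rw [Yt, trace_mul_comm, ← Matrix.mul_assoc, U_inv_mul_U, Matrix.one_mul]

lemma isModifiedSolution_iff {u : ℝ → ℂ} {z : ℂ} {ψ : ℝ → Fin 2 → ℂ} :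
    IsModifiedSolution u z ψ ↔ IsSolution u z (fun x => U⁻¹ *ᵥ ψ x) := by
  constructor
  · intro h x
    have := mulVec_hasDerivAt U⁻¹ (h x)
    rwa [mulVec_mulVec, ← Matrix.mul_assoc, ← Matrix.mul_assoc, U_inv_mul_U, Matrix.one_mul,
      ← mulVec_mulVec] at this
  · intro h x
    have := mulVec_hasDerivAt U (h x)
    simpa only [mulVec_mulVec, ← Matrix.mul_assoc, U_mul_U_inv, one_mulVec] using! this

lemma isModifiedSolution_Yt {u : ℝ → ℂ} (hu : Continuous u) (z : ℂ) (c : Fin 2 → ℂ) :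
    IsModifiedSolution u z (fun x => Yt u z x *ᵥ c) := by
  rw [isModifiedSolution_iff]
  have := isSolution_Y hu z (U⁻¹ *ᵥ c)
  simpa only [Yt, mulVec_mulVec, ← Matrix.mul_assoc, U_inv_mul_U, Matrix.one_mul] using! this

lemma IsModifiedSolution.eq_Yt {u : ℝ → ℂ} (hu : Continuous u) {z : ℂ} {ψ : ℝ → Fin 2 → ℂ}
    (h : IsModifiedSolution u z ψ) (x : ℝ) : ψ x = Yt u z x *ᵥ ψ 0 := by
  have h1 := (isModifiedSolution_iff.1 h).eq_Y hu x
  have h2 := congrArg (fun v => U *ᵥ v) h1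
  simpa only [Yt, mulVec_mulVec, ← Matrix.mul_assoc, U_mul_U_inv, one_mulVec] using h2

lemma IsSolution.shift {u : ℝ → ℂ} {L : ℝ} (hper : ∀ x, u (x + L) = u x) {z : ℂ}
    {v : ℝ → Fin 2 → ℂ} (hv : IsSolution u z v) : IsSolution u z (fun x => v (x + L)) := by
  intro x
  have := (hv (x + L)).comp_add_const x L
  simpa only [X, hper] using this

lemma Y_add {u : ℝ → ℂ} (hu : Continuous u) {L : ℝ} (hper : ∀ x, u (x + L) = u x) (z : ℂ) (x : ℝ) :
    Y u z (x + L) = Y u z x * Y u z L := by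
  refine Matrix.ext_of_mulVec_single fun j => ?_
  have := ((isSolution_Y hu z (Pi.single j 1)).shift hper).eq_Y hu x
  rw [← mulVec_mulVec]
  simpa using this

lemma Yt_add {u : ℝ → ℂ} (hu : Continuous u) {L : ℝ} (hper : ∀ x, u (x + L) = u x) (z : ℂ) (x : ℝ) :
    Yt u z (x + L) = Yt u z x * Yt u z L := by
  simp only [Yt, Y_add hu hper, Matrix.mul_assoc]
  rw [← Matrix.mul_assoc U⁻¹, U_inv_mul_U, Matrix.one_mul]

end Basics

/-! ### Floquet theory: Bloch solutions, Dirichlet spectrum and Lax spectrum -/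

section Floquet

open Matrix

variable {u : ℝ → ℂ} {L : ℝ}

lemma mulVec_one_eq_smul_iff {A : Matrix (Fin 2) (Fin 2) ℂ} {m w : ℂ} :
    A *ᵥ ![1, w] = m • ![1, w] ↔ A 0 0 + A 0 1 * w = m ∧ A 1 0 + A 1 1 * w = m * w := by
  rw [← List.ofFn_inj]
  simp

/-- A solution is fixed by its value `(1,w)` at `0`, and `Yt (x + L) = Yt x * Yt L` reduces
quasi-periodicity to an eigenvector condition on the monodromy matrix. -/
lemma isBlochFloquet_iff (hu : Continuous u) (hper : ∀ x, u (x + L) = u x) {m z : ℂ}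
    {ψ : ℝ → Fin 2 → ℂ} : IsBlochFloquet u L m z ψ ↔
      ∃ w, ψ = (fun x => Yt u z x *ᵥ ![1, w]) ∧ Yt u z L *ᵥ ![1, w] = m • ![1, w] := by
  constructor
  · rintro ⟨h1, h2, h3⟩
    have h0 : ψ 0 = ![1, ψ 0 1] := by
      ext i; fin_cases i <;> simp [h3]
    refine ⟨ψ 0 1, ?_, ?_⟩
    · ext1 x
      rw [← h0]; exact h1.eq_Yt hu x
    · rw [← h0, ← h1.eq_Yt hu L, ← h2 0, zero_add]
  · rintro ⟨w, rfl, hw⟩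
    refine ⟨isModifiedSolution_Yt hu z _, fun x => ?_, ?_⟩
    · simp only [Yt_add hu hper]
      rw [← mulVec_mulVec, hw, mulVec_smul]
    · simp [Yt_zero hu]

lemma charpoly_Yt (hu : Continuous u) {m z : ℂ} (hm : m ^ 2 - 2 * Delta u L z * m + 1 = 0) :
    (m - Yt u z L 0 0) * (m - Yt u z L 1 1) = Yt u z L 0 1 * Yt u z L 1 0 := by
  have h1 := det_Yt hu z L
  have h2 := trace_Yt u z L
  rw [Delta, ← h2, trace_fin_two] at hm
  rw [det_fin_two] at h1
  linear_combination hm + h1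

/-- Either row of the eigenvector equation can be solved for `w` when its coefficient is nonzero;
the characteristic equation supplies the other row. -/
lemma exists_eigenvector (hu : Continuous u) {m z : ℂ}
    (hm : m ^ 2 - 2 * Delta u L z * m + 1 = 0) (h : Yt u z L 0 1 ≠ 0 ∨ Yt u z L 1 1 ≠ m) :
    ∃ w, Yt u z L *ᵥ ![1, w] = m • ![1, w] := by
  have hc := charpoly_Yt hu hm
  rcases h with h | h
  · refine ⟨(m - Yt u z L 0 0) / Yt u z L 0 1, mulVec_one_eq_smul_iff.2 ⟨?_, ?_⟩⟩ <;> field_simp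
    · ring
    · linear_combination -hc
  · have h' : m - Yt u z L 1 1 ≠ 0 := sub_ne_zero.2 (Ne.symm h)
    refine ⟨Yt u z L 1 0 / (m - Yt u z L 1 1), mulVec_one_eq_smul_iff.2 ⟨?_, ?_⟩⟩ <;> field_simp
    · linear_combination -hc
    · ring

/-- The alternative `h` says that `(0,1)` is not an eigenvector for `m`. Two normalized eigenvectors
differ by a multiple of `(0,1)`, hence coincide. -/
lemma bfDefined_and_psi_eq (hu : Continuous u) (hper : ∀ x, u (x + L) = u x) {m z w : ℂ}
    (h : Yt u z L 0 1 ≠ 0 ∨ Yt u z L 1 1 ≠ m) (hw : Yt u z L *ᵥ ![1, w] = m • ![1, w]) :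
    BFDefined u L m z ∧ psi u L m z = fun x => Yt u z x *ᵥ ![1, w] := by
  have hd : ∃! ψ, IsBlochFloquet u L m z ψ := by
    refine ⟨_, (isBlochFloquet_iff hu hper).2 ⟨w, rfl, hw⟩, fun ψ hψ => ?_⟩
    obtain ⟨w', rfl, hw'⟩ := (isBlochFloquet_iff hu hper).1 hψ
    rw [mulVec_one_eq_smul_iff] at hw hw'
    suffices w' = w by rw [this]
    rcases h with h | h
    · exact mul_left_cancel₀ h (by linear_combination hw'.1 - hw.1)
    · exact mul_left_cancel₀ (sub_ne_zero.2 h) (by linear_combination hw'.2 - hw.2)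
  refine ⟨hd, ?_⟩
  have hd' : BFDefined u L m z := hd
  rw [psi, dif_pos hd']
  exact hd.unique hd'.choose_spec.1 ((isBlochFloquet_iff hu hper).2 ⟨w, rfl, hw⟩)

/-- If `(0,1)` were an eigenvector for `m`, adding it to `(1,w)` would give a second normalized
solution. -/
lemma BFDefined.ne_or_ne (hu : Continuous u) (hper : ∀ x, u (x + L) = u x) {m z : ℂ}
    (h : BFDefined u L m z) : Yt u z L 0 1 ≠ 0 ∨ Yt u z L 1 1 ≠ m := by
  by_contra! hc
  obtain ⟨ψ, hψ, huniq⟩ := h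
  obtain ⟨w, rfl, hw⟩ := (isBlochFloquet_iff hu hper).1 hψ
  have hw' : Yt u z L *ᵥ ![1, w + 1] = m • ![1, w + 1] := by
    rw [mulVec_one_eq_smul_iff] at hw ⊢
    exact ⟨by linear_combination hw.1 + hc.1, by linear_combination hw.2 + hc.2⟩
  have := huniq _ ((isBlochFloquet_iff hu hper).2 ⟨w + 1, rfl, hw'⟩)
  have := congrFun (congrFun this 0) 1
  simp [Yt_zero hu] at this

/-- Up to a factor `v₁ + v₂` is the first component of `U v`. A Dirichlet solution is thus a
multiple of the one starting at `(0,1)` in the modified frame, whose first component at `L` is `Yt L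
0 1`. -/
lemma mem_dirichletSpectrum_iff (hu : Continuous u) (hL : 0 < L) {μ : ℂ} :
    μ ∈ dirichletSpectrum u L ↔ Yt u μ L 0 1 = 0 := by
  have hYt : Yt u μ L 0 1 = Complex.I / 2 *
      (Y u μ L 0 0 - Y u μ L 0 1 + Y u μ L 1 0 - Y u μ L 1 1) := by
    rw [Yt, U_conj]
    simp
    ring
  rw [hYt, mul_eq_zero_iff_left (by simp)]
  constructor
  · rintro ⟨v, hv, ⟨x, hx, hvx⟩, h0, h1⟩
    -- The given solution lives only on `[0,L]` with one-sided derivatives at the ends, so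
    -- uniqueness is proved there directly by a Grönwall argument.
    have heq : ∀ x ∈ Set.Icc 0 L, v x = Y u μ x *ᵥ v 0 := by
      obtain ⟨K, hK, hb⟩ := exists_abs_bound hu μ L
      have hs := isSolution_Y hu μ (v 0)
      intro x hx
      refine sub_eq_zero.1 (eq_zero_of_abs_deriv_le_mul_abs_self_of_eq_zero_right
        (f := fun x => v x - Y u μ x *ᵥ v 0) (f' := fun x => X u μ x *ᵥ (v x - Y u μ x *ᵥ v 0))
        (K := K) (a := 0) (b := L) ?_ ?_ ?_ ?_ x hx)
      · exact fun y hy => (hv y hy).continuousWithinAt.sub (hs y).continuousAt.continuousWithinAt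
      · intro y hy
        rw [mulVec_sub]
        exact ((hv y (Set.Ico_subset_Icc_self hy)).mono_of_mem_nhdsWithin
          (Icc_mem_nhdsGE_of_mem hy)).sub (hs y).hasDerivWithinAt
      · simp only [Y_zero hu, one_mulVec, sub_self]
      · intro y hy
        refine (norm_X_mulVec_le u μ y _).trans ?_
        gcongr
        exact hb y (abs_le.2 ⟨by linarith [hy.1], hy.2.le⟩)
    have hc : v 0 1 = -v 0 0 := by linear_combination h0
    have hv0 : v 0 0 ≠ 0 := by
      intro h
      have : v 0 = 0 := by ext i; fin_cases i <;> simp [h, hc]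
      exact hvx (by rw [heq x hx, this, mulVec_zero])
    have h2 := heq L ⟨hL.le, le_rfl⟩
    have h3 := congrFun h2 0
    have h4 := congrFun h2 1
    simp only [mulVec, dotProduct, Fin.sum_univ_two, hc] at h3 h4
    refine (mul_eq_zero.1 (?_ : v 0 0 * _ = 0)).resolve_left hv0
    linear_combination h1 - h3 - h4
  · intro h
    refine ⟨fun x => Y u μ x *ᵥ ![1, -1], fun x _ => (isSolution_Y hu μ _ x).hasDerivWithinAt,
      ⟨0, ⟨le_rfl, hL.le⟩, ?_⟩, ?_, ?_⟩
    · simp only [Y_zero hu, one_mulVec]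
      exact fun h => one_ne_zero (congrFun h 0)
    · simp [Y_zero hu]
    · simp only [mulVec, dotProduct, Fin.sum_univ_two]
      simp
      linear_combination h

lemma exists_multiplicative_solution (hu : Continuous u) (hper : ∀ x, u (x + L) = u x) {m z : ℂ}
    (hm : m ^ 2 - 2 * Delta u L z * m + 1 = 0) :
    ∃ v, IsSolution u z v ∧ v 0 ≠ 0 ∧ ∀ x, v (x + L) = m • v x := by
  have hdet : (Y u z L - m • 1).det = 0 := by
    have h1 := det_Y hu z L
    rw [det_fin_two] at h1
    rw [Delta, trace_fin_two] at hm
    rw [det_fin_two]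
    simp
    linear_combination h1 + hm
  obtain ⟨c, hc, hAc⟩ := exists_mulVec_eq_zero_iff.2 hdet
  rw [sub_mulVec, smul_mulVec, one_mulVec, sub_eq_zero] at hAc
  refine ⟨_, isSolution_Y hu z c, by simpa only [Y_zero hu, one_mulVec] using hc, fun x => ?_⟩
  simp only [Y_add hu hper]
  rw [← mulVec_mulVec, hAc, mulVec_smul]

lemma eq_zero_of_bounded_of_expanding {f : ℝ → Fin 2 → ℂ} {m : ℂ} {C : ℝ} (hm : 1 < ‖m‖)
    (hf : ∀ x, f (x + L) = m • f x) (hb : ∀ x, ‖f x‖ ≤ C) (x : ℝ) : f x = 0 := by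
  by_contra hx
  have hn : ∀ n : ℕ, ‖m‖ ^ n * ‖f x‖ = ‖f (x + n * L)‖ := by
    intro n
    induction n with
    | zero => simp
    | succ n ih =>
      rw [Nat.cast_succ, add_mul, one_mul, ← add_assoc, hf, norm_smul, ← ih]; ring
  obtain ⟨n, hn'⟩ := pow_unbounded_of_one_lt (C / ‖f x‖) hm
  rw [div_lt_iff₀ (norm_pos_iff.2 hx), hn] at hn'
  exact absurd (hb _) (not_le.2 hn')

lemma mul_self_eq_trace_smul_sub_one {A : Matrix (Fin 2) (Fin 2) ℂ} (h : A.det = 1) :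
    A * A = A.trace • A - 1 := by
  rw [det_fin_two] at h
  ext i j
  fin_cases i <;> fin_cases j <;> simp [mul_apply, trace_fin_two] <;>
    first | ring1 | linear_combination (-1 : ℂ) * h

/-- The criterion involves only `Δ`, so a conserved `Δ` makes the Lax spectrum conserved. If no root
has modulus one, the roots are `m` and `m⁻¹` with `‖m‖ > 1`, and a bounded solution is killed by two
applications of exponential growth. A multiplier of modulus one makes `‖v‖` periodic. -/
lemma mem_laxSpectrum_iff (hu : Continuous u) (hper : ∀ x, u (x + L) = u x) (hL : 0 < L) {z : ℂ} :
    z ∈ laxSpectrum u ↔ ∃ m : ℂ, ‖m‖ = 1 ∧ m ^ 2 - 2 * Delta u L z * m + 1 = 0 := by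
  constructor
  · rintro ⟨v, hv, hv0, C, hC⟩
    by_contra! hcon
    have hroot : ∃ m : ℂ, m ^ 2 - 2 * Delta u L z * m + 1 = 0 := by
      obtain ⟨s, hs⟩ := IsAlgClosed.exists_pow_nat_eq (Delta u L z ^ 2 - 1) two_pos
      exact ⟨Delta u L z + s, by linear_combination hs⟩
    obtain ⟨m, hm, hm1⟩ : ∃ m : ℂ, m ^ 2 - 2 * Delta u L z * m + 1 = 0 ∧ 1 < ‖m‖ := by
      obtain ⟨m, hm⟩ := hroot
      have hm0 : m ≠ 0 := by rintro rfl; simp at hm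
      rcases lt_trichotomy ‖m‖ 1 with h | h | h
      · refine ⟨m⁻¹, ?_, ?_⟩
        · field_simp; linear_combination hm
        · rw [norm_inv]; exact (one_lt_inv₀ (norm_pos_iff.2 hm0)).2 h
      · exact absurd hm (hcon m h)
      · exact ⟨m, hm, h⟩
    have hm0 : m ≠ 0 := by rintro rfl; simp at hm
    have htr : (Y u z L).trace = m + m⁻¹ := by
      rw [Delta] at hm; field_simp; linear_combination -hm
    have hv2 : ∀ x, v (x + L + L) = (m + m⁻¹) • v (x + L) - v x := by
      intro x
      have e0 := hv.eq_Y hu x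
      have e1 : v (x + L) = Y u z x *ᵥ (Y u z L *ᵥ v 0) := by
        rw [hv.eq_Y hu (x + L), Y_add hu hper, mulVec_mulVec]
      have e2 : v (x + L + L) = Y u z x *ᵥ ((Y u z L * Y u z L) *ᵥ v 0) := by
        rw [hv.eq_Y hu (x + L + L), Y_add hu hper, Y_add hu hper, mulVec_mulVec, Matrix.mul_assoc]
      rw [e2, mul_self_eq_trace_smul_sub_one (det_Y hu z L), htr, e1, e0, sub_mulVec, one_mulVec,
        mulVec_sub, smul_mulVec, mulVec_smul]
    -- By Cayley–Hamilton, translation by `L` multiplies this bounded combination by `m`, so it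
    -- vanishes.
    have hE : ∀ x, v (x + L) - m⁻¹ • v x = 0 := by
      refine eq_zero_of_bounded_of_expanding (L := L) (f := fun x => v (x + L) - m⁻¹ • v x)
        (C := C + ‖m⁻¹‖ * C) hm1 (fun x => ?_) (fun x => ?_)
      · simp only [hv2, smul_sub, smul_smul, mul_inv_cancel₀ hm0, one_smul, add_smul]
        abel
      · refine (norm_sub_le _ _).trans (add_le_add (hC _) ?_)
        rw [norm_smul]; gcongr; exact hC x
    -- What remains has multiplier `m⁻¹`, so it grows by the factor `m` per period to the left.
    have hz : ∀ x, v (-x) = 0 := by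
      refine eq_zero_of_bounded_of_expanding (L := L) (f := fun x => v (-x)) (C := C) hm1 (fun x => ?_)
        (fun x => hC _)
      have := hE (-(x + L))
      rw [show -(x + L) + L = -x by ring, sub_eq_zero] at this
      rw [this, smul_smul, mul_inv_cancel₀ hm0, one_smul]
    exact hv0 (funext fun x => by simpa using hz (-x))
  · rintro ⟨m, hm1, hm⟩
    obtain ⟨v, hs, hv0, hv⟩ := exists_multiplicative_solution hu hper hm
    refine ⟨v, hs, fun h => hv0 (congrFun h 0), ?_⟩
    have hp : Function.Periodic (fun x => ‖v x‖) L := fun x => by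
      simp only [hv, norm_smul, hm1, one_mul]
    have hcont : Continuous fun x => ‖v x‖ :=
      (continuous_iff_continuousAt.2 fun x => (hs x).continuousAt).norm
    obtain ⟨C, hC⟩ := (hp.compact_of_continuous hL.ne' hcont).isBounded.bddAbove
    exact ⟨C, fun x => hC ⟨x, rfl⟩⟩

end Floquet

/-! ### Zero curvature and first-order dependence on `z` and `t` -/

section Parameters

open Matrix

/-- The matrix of the time part of the Lax pair. -/
noncomputable def timeMatrix (u : ℝ → ℂ) (z : ℂ) (x : ℝ) : Matrix (Fin 2) (Fin 2) ℂ :=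
  !![-2 * Complex.I * z ^ 2 + Complex.I * (u x * (starRingEnd ℂ) (u x)),
      2 * z * u x + Complex.I * deriv u x;
    -2 * z * (starRingEnd ℂ) (u x) + Complex.I * (starRingEnd ℂ) (deriv u x),
      2 * Complex.I * z ^ 2 - Complex.I * (u x * (starRingEnd ℂ) (u x))]

/-- The time derivative that the nonlinear Schrödinger equation prescribes for a potential. -/
noncomputable def nlsFlow (u : ℝ → ℂ) (x : ℝ) : ℂ :=
  Complex.I * (deriv (deriv u) x + 2 * (u x * (starRingEnd ℂ) (u x)) * u x)

lemma timeMatrix_mulVec (u : ℝ → ℂ) (z : ℂ) (x : ℝ) (v : Fin 2 → ℂ) :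
    timeMatrix u z x *ᵥ v =
      ![(-2 * Complex.I * z ^ 2 + Complex.I * (u x * (starRingEnd ℂ) (u x))) * v 0 +
          (2 * z * u x + Complex.I * deriv u x) * v 1,
        (-2 * z * (starRingEnd ℂ) (u x) + Complex.I * (starRingEnd ℂ) (deriv u x)) * v 0 +
          (2 * Complex.I * z ^ 2 - Complex.I * (u x * (starRingEnd ℂ) (u x))) * v 1] := by
  ext i; fin_cases i <;> simp [timeMatrix, mulVec, dotProduct, Fin.sum_univ_two]

lemma hasDerivAt_conj {f : ℝ → ℂ} {f' : ℂ} {x : ℝ} (h : HasDerivAt f f' x) :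
    HasDerivAt (fun y => (starRingEnd ℂ) (f y)) ((starRingEnd ℂ) f') x := by
  simpa using! h.star

/-- The zero-curvature equation in integrated form. -/
lemma hasDerivAt_timeMatrix_mulVec {u : ℝ → ℂ} (hu : ContDiff ℝ 2 u) {z : ℂ}
    {v : ℝ → Fin 2 → ℂ} (hv : IsSolution u z v) (x : ℝ) :
    HasDerivAt (fun y => timeMatrix u z y *ᵥ v y)
      (X u z x *ᵥ (timeMatrix u z x *ᵥ v x) + X (nlsFlow u) 0 x *ᵥ v x) x := by
  have h0 : HasDerivAt u (deriv u x) x := (hu.differentiable (by norm_num) x).hasDerivAt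
  have h1 : HasDerivAt (deriv u) (deriv (deriv u) x) x :=
    ((hu.differentiable_deriv_two) x).hasDerivAt
  have c0 := hasDerivAt_conj h0
  have c1 := hasDerivAt_conj h1
  have hn := h0.mul c0
  have hv' := hasDerivAt_pi.1 (hv x)
  have v0 := hv' 0
  have v1 := hv' 1
  rw [X_mulVec] at v0 v1
  rw [hasDerivAt_pi]
  intro i
  fin_cases i
  · refine HasDerivAt.congr_deriv ((((hn.const_mul Complex.I).const_add
      (-2 * Complex.I * z ^ 2)).mul v0).add (((h0.const_mul (2 * z)).add
        (h1.const_mul Complex.I)).mul v1) |>.congr_of_eventuallyEq (.of_forall fun y => ?_)) ?_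
    · simp only [timeMatrix_mulVec]
      rfl
    · simp only [timeMatrix_mulVec, X_mulVec, nlsFlow, Pi.add_apply, Pi.mul_apply]
      simp
      ring_nf
      simp
      ring
  · refine HasDerivAt.congr_deriv ((((c0.const_mul (-2 * z)).add
      (c1.const_mul Complex.I)).mul v0).add (((hn.const_mul Complex.I).const_sub
      (2 * Complex.I * z ^ 2)).mul v1) |>.congr_of_eventuallyEq (.of_forall fun y => ?_)) ?_
    · simp only [timeMatrix_mulVec]
      rfl
    · simp only [timeMatrix_mulVec, X_mulVec, nlsFlow, Pi.add_apply, Pi.mul_apply]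
      simp
      ring_nf
      simp [map_ofNat]
      ring

variable {L : ℝ} {I : Set ℝ} {q : ℝ → ℝ → ℂ}

lemma IsPeriodicNLSSolution.hasDerivWithinAt (hq : IsPeriodicNLSSolution L I q) (x : ℝ) {t : ℝ}
    (ht : t ∈ I) : HasDerivWithinAt (q x) (nlsFlow (fun y => q y t) x) I t := by
  have h := (hq.differentiable_t x t ht).hasDerivWithinAt
  have h2 := hq.nls x t ht
  refine h.congr_deriv ?_
  have h3 : ((‖q x t‖ : ℝ) : ℂ) ^ 2 = q x t * (starRingEnd ℂ) (q x t) := by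
    rw [Complex.mul_conj']
  rw [h3] at h2
  rw [nlsFlow]
  linear_combination (-Complex.I) * h2 + derivWithin (fun s => q x s) I t * Complex.I_sq

lemma IsPeriodicNLSSolution.continuousOn_nlsFlow (hq : IsPeriodicNLSSolution L I q) :
    ContinuousOn (fun p : ℝ × ℝ => nlsFlow (fun y => q y p.2) p.1) (Set.univ ×ˢ I) := by
  have h1 := hq.continuous
  have h2 := hq.continuous_xx
  have h3 : ContinuousOn (fun p : ℝ × ℝ => (starRingEnd ℂ) (q p.1 p.2)) (Set.univ ×ˢ I) :=
    Complex.continuous_conj.comp_continuousOn h1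
  unfold nlsFlow
  fun_prop

/-- Pointwise differentiability in time is too weak to differentiate solutions of the system;
uniformity on compact `x`-sets is needed. Joint continuity of `q_t` keeps it uniformly close to its
value at time `t`, and the mean value inequality applies to `q x r - r q_t x t`. -/
lemma IsPeriodicNLSSolution.uniform_time_expansion (hI : I.OrdConnected)
    (hq : IsPeriodicNLSSolution L I q) {t : ℝ} (ht : t ∈ I) (R : ℝ) {ε : ℝ} (hε : 0 < ε) :
    ∀ᶠ s in 𝓝[I] t, ∀ x, |x| ≤ R →
      ‖q x s - q x t - ((s - t : ℝ) : ℂ) * nlsFlow (fun y => q y t) x‖ ≤ ε * |s - t| := by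
  have hcont : Continuous fun p : ℝ × I => nlsFlow (fun y => q y p.2) p.1 :=
    hq.continuousOn_nlsFlow.comp_continuous (f := fun p : ℝ × I => (p.1, (p.2 : ℝ)))
      (by fun_prop) fun p => ⟨trivial, p.2.2⟩
  have h1 : ∀ᶠ s : I in 𝓝 ⟨t, ht⟩, ∀ x ∈ Set.Icc (-R) R,
      ‖nlsFlow (fun y => q y s) x - nlsFlow (fun y => q y t) x‖ < ε := by
    refine isCompact_Icc.eventually_forall_of_forall_eventually fun x _ => ?_
    have hc : Continuous fun p : I × ℝ => ‖nlsFlow (fun y => q y p.1) p.2 -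
        nlsFlow (fun y => q y t) p.2‖ :=
      ((hcont.comp (continuous_snd.prodMk continuous_fst)).sub
        (hcont.comp (continuous_snd.prodMk (continuous_const (y := (⟨t, ht⟩ : I)))))).norm
    have := hc.tendsto (⟨t, ht⟩, x)
    refine this.eventually_lt_const ?_
    simpa using hε
  rw [eventually_nhds_subtype_iff (s := I) (a := ⟨t, ht⟩) (P := fun s => ∀ x ∈ Set.Icc (-R) R,
      ‖nlsFlow (fun y => q y s) x - nlsFlow (fun y => q y t) x‖ < ε)] at h1
  obtain ⟨δ, hδ, hball⟩ := Metric.mem_nhdsWithin_iff.1 h1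
  have hconv : Convex ℝ (Metric.ball t δ ∩ I) := (convex_ball t δ).inter hI.convex
  filter_upwards [inter_mem_nhdsWithin I (Metric.ball_mem_nhds t hδ)] with s hs x hx
  have key := hconv.norm_image_sub_le_of_norm_hasDerivWithin_le
    (f := fun r => q x r - (r : ℂ) * nlsFlow (fun y => q y t) x)
    (f' := fun r => nlsFlow (fun y => q y r) x - nlsFlow (fun y => q y t) x) (C := ε)
    (fun r hr => ?_) (fun r hr => (hball hr x (abs_le.1 hx)).le)
    (⟨Metric.mem_ball_self hδ, ht⟩ : t ∈ Metric.ball t δ ∩ I) ⟨hs.2, hs.1⟩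
  · rw [Real.norm_eq_abs] at key
    refine le_trans (le_of_eq ?_) key
    congr 1
    push_cast
    ring
  · have e1 := (hq.hasDerivWithinAt x hr.2).mono (Set.inter_subset_right (s := Metric.ball t δ))
    have e2 := ((Complex.ofRealCLM.hasDerivAt (x := r)).mul_const
      (nlsFlow (fun y => q y t) x)).hasDerivWithinAt (s := Metric.ball t δ ∩ I)
    simpa using! e1.sub e2

lemma IsPeriodicNLSSolution.continuous_slice (hq : IsPeriodicNLSSolution L I q) {t : ℝ}
    (ht : t ∈ I) : Continuous fun x => q x t := (hq.contDiff t ht).continuous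

/-- Joint first-order expansion of a solution in the spectral parameter and in time. -/
lemma IsPeriodicNLSSolution.isLittleO_solution (hI : I.OrdConnected)
    (hq : IsPeriodicNLSSolution L I q) {t : ℝ} (ht : t ∈ I) (z : ℂ) (c : Fin 2 → ℂ)
    {W₁ W₂ : ℝ → Fin 2 → ℂ} (h10 : W₁ 0 = 0) (h20 : W₂ 0 = 0)
    (h1 : ∀ x, HasDerivAt W₁ (X (fun y => q y t) z x *ᵥ W₁ x +
      X 0 1 x *ᵥ (Y (fun y => q y t) z x *ᵥ c)) x)
    (h2 : ∀ x, HasDerivAt W₂ (X (fun y => q y t) z x *ᵥ W₂ x +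
      X (nlsFlow fun y => q y t) 0 x *ᵥ (Y (fun y => q y t) z x *ᵥ c)) x) (x : ℝ) :
    (fun p : ℂ × ℝ => Y (fun y => q y p.2) p.1 x *ᵥ c - Y (fun y => q y t) z x *ᵥ c
      - ((p.1 - z) • W₁ x + ((p.2 - t : ℝ) : ℂ) • W₂ x)) =o[𝓝[Set.univ ×ˢ I] (z, t)]
      fun p => p - (z, t) := by
  have hut := hq.continuous_slice ht
  have hV := isSolution_Y hut z c
  set V : ℝ → Fin 2 → ℂ := fun x => Y (fun y => q y t) z x *ᵥ c with hVdef
  have hVy : ∀ y, Y (fun y => q y t) z y *ᵥ c = V y := fun _ => rfl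
  have hVc : Continuous V := continuous_iff_continuousAt.2 fun x => (hV x).continuousAt
  set R := |x|
  obtain ⟨M, hM⟩ := (isCompact_Icc (a := -R) (b := R)).exists_bound_of_continuousOn hVc.continuousOn
  obtain ⟨D, hD⟩ := (isCompact_Icc (a := -R) (b := R)).exists_bound_of_continuousOn
    (f := fun x => nlsFlow (fun y => q y t) x)
    ((hq.continuousOn_nlsFlow.comp_continuous (f := fun x : ℝ => (x, t))
      (by fun_prop) fun p => ⟨trivial, ht⟩).continuousOn)
  obtain ⟨B, hB⟩ := (isCompact_Icc (a := -R) (b := R)).exists_bound_of_continuousOn hut.continuousOn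
  have hmem : (0 : ℝ) ∈ Set.Icc (-R) R := by simp [R]
  have hM0 : 0 ≤ M := (norm_nonneg _).trans (hM 0 hmem)
  have hD0 : 0 ≤ D := (norm_nonneg _).trans (hD 0 hmem)
  have hB0 : 0 ≤ B := (norm_nonneg _).trans (hB 0 hmem)
  -- A bound for the coefficient matrix at every parameter within distance one: `‖z‖ + 1` for the
  -- spectral parameter and `B + (D + 1)` for the perturbed potential.
  set K := 1 + (‖z‖ + 1) + B + (D + 1) with hK
  have hK1 : 1 ≤ K := by rw [hK]; linarith [norm_nonneg z]
  -- The constant that the second Grönwall estimate `hfin` produces in front of `ε * h`.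
  set C := (M + (D + 2) * ((D + 2) * M * Real.exp (K * R))) * Real.exp (K * R) with hC
  have hC0 : 0 ≤ C := by positivity
  rw [isLittleO_iff]
  intro c' hc'
  set ε := c' / (C + 1) with hεdef
  have hε : 0 < ε := by positivity
  have hεC : C * ε ≤ c' := by
    rw [hεdef, mul_div_assoc', div_le_iff₀ (by positivity)]; nlinarith
  have hfst : Tendsto Prod.snd (𝓝[Set.univ ×ˢ I] (z, t)) (𝓝[I] t) := by
    rw [nhdsWithin_prod_eq]; exact tendsto_snd
  have hnear : ∀ᶠ p : ℂ × ℝ in 𝓝[Set.univ ×ˢ I] (z, t), ‖p - (z, t)‖ < min 1 ε := by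
    refine Tendsto.eventually_lt_const (v := 0) (lt_min one_pos hε) ?_
    have : Continuous fun p : ℂ × ℝ => ‖p - (z, t)‖ := by fun_prop
    simpa using (this.tendsto (z, t)).mono_left nhdsWithin_le_nhds
  filter_upwards [hnear, self_mem_nhdsWithin,
    hfst.eventually (hq.uniform_time_expansion hI ht R hε),
    hfst.eventually (hq.uniform_time_expansion hI ht R one_pos)] with p hp hpI he he1
  obtain ⟨z', s⟩ := p
  simp only [Prod.mk_sub_mk] at hp hpI he he1 ⊢
  set h := ‖((z' - z, s - t) : ℂ × ℝ)‖ with hh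
  have hhz : ‖z' - z‖ ≤ h := norm_fst_le ((z' - z, s - t) : ℂ × ℝ)
  have hhs : |s - t| ≤ h := norm_snd_le ((z' - z, s - t) : ℂ × ℝ)
  have hh1 : h ≤ 1 := (hp.trans_le (min_le_left _ _)).le
  have hhε : h ≤ ε := (hp.trans_le (min_le_right _ _)).le
  have hh0 : 0 ≤ h := norm_nonneg _
  have hus : Continuous fun y => q y s := hq.continuous_slice hpI.2
  have hV' := isSolution_Y hus z' c
  set V' : ℝ → Fin 2 → ℂ := fun x => Y (fun y => q y s) z' x *ᵥ c with hVdef'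
  have hdiff : ∀ y, |y| ≤ R → ‖q y s - q y t‖ ≤ (D + 1) * h := by
    intro y hy
    have e1 := he1 y hy
    have e2 : q y s - q y t = (q y s - q y t - ((s - t : ℝ) : ℂ) * nlsFlow (fun y => q y t) y)
      + ((s - t : ℝ) : ℂ) * nlsFlow (fun y => q y t) y := by ring
    rw [e2]
    refine (norm_add_le _ _).trans ?_
    have e3 : ‖((s - t : ℝ) : ℂ) * nlsFlow (fun y => q y t) y‖ ≤ h * D := by
      rw [norm_mul, Complex.norm_real]
      exact mul_le_mul hhs (hD y (abs_le.1 hy)) (norm_nonneg _) hh0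
    linarith
  -- First Grönwall pass: the perturbed solution is within `O(h)` of the unperturbed one.
  have hΔ : ∀ y, |y| ≤ R → ‖V' y - V y‖ ≤ (D + 2) * M * Real.exp (K * R) * h := by
    intro y hy
    have := norm_le_of_norm_deriv_le (f := fun y => V' y - V y)
      (f' := fun y => X (fun y => q y s) z' y *ᵥ (V' y - V y)
        + X (fun y => q y s - q y t) (z' - z) y *ᵥ V y) (δ := 0) (ε := (D + 2) * h * M) (R := R)
      hK1 (by positivity) (fun y => ?_) ?_ ?_ hy
    · refine this.trans (le_of_eq (by ring))
    · refine ((hV' y).sub (hV y)).congr_deriv ?_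
      simp only [X_mulVec]
      ext i
      fin_cases i <;> simp <;> ring
    · simp [hVdef, hVdef', Y_zero hus, Y_zero hut]
    · intro y hy
      refine (norm_add_le _ _).trans (add_le_add ?_ ?_)
      · refine (norm_X_mulVec_le _ _ _ _).trans ?_
        gcongr
        have e1 : ‖z'‖ ≤ ‖z‖ + 1 := by
          have := norm_le_norm_add_norm_sub z z'
          rw [norm_sub_rev] at this
          linarith
        have e2 : ‖q y s‖ ≤ B + (D + 1) := by
          have := norm_le_norm_add_norm_sub (q y t) (q y s)
          rw [norm_sub_rev] at this
          have := hB y (abs_le.1 hy)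
          have := hdiff y hy
          nlinarith
        rw [hK]; linarith
      · refine (norm_X_mulVec_le _ _ _ _).trans ?_
        have := hdiff y hy
        exact mul_le_mul (by linarith) (hM y (abs_le.1 hy)) (norm_nonneg _) (by positivity)
  -- Second pass: the remainder is forced by the error of the time expansion, which is at most `ε
  -- h`, and by a product of two `O(h)` factors, one of which gives up its `h ≤ ε`.
  have hfin := norm_le_of_norm_deriv_le
    (f := fun y => V' y - V y - ((z' - z) • W₁ y + ((s - t : ℝ) : ℂ) • W₂ y))
    (f' := fun y => X (fun y => q y t) z y *ᵥ
        (V' y - V y - ((z' - z) • W₁ y + ((s - t : ℝ) : ℂ) • W₂ y))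
      + X (fun y => q y s - q y t - ((s - t : ℝ) : ℂ) * nlsFlow (fun y => q y t) y) 0 y *ᵥ V y
      + X (fun y => q y s - q y t) (z' - z) y *ᵥ (V' y - V y))
    (δ := 0) (ε := ε * h * M + (D + 2) * h * ((D + 2) * M * Real.exp (K * R) * h)) (R := R)
    hK1 (by positivity) (fun y => ?_) ?_ ?_ (le_refl |x|)
  · refine hfin.trans ?_
    have : (D + 2) * h * ((D + 2) * M * Real.exp (K * R) * h)
        ≤ (D + 2) * ε * ((D + 2) * M * Real.exp (K * R) * h) := by gcongr
    calc _ ≤ (0 + (ε * h * M + (D + 2) * ε * ((D + 2) * M * Real.exp (K * R) * h)))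
          * Real.exp (K * R) := by gcongr
      _ = C * ε * h := by rw [hC]; ring
      _ ≤ c' * h := by gcongr
  · refine (((hV' y).sub (hV y)).sub (((h1 y).const_smul (z' - z)).add
      ((h2 y).const_smul ((s - t : ℝ) : ℂ)))).congr_deriv ?_
    simp only [hVy, X_mulVec]
    ext i
    fin_cases i <;> simp <;> ring
  · simp [hVdef, hVdef', Y_zero hus, Y_zero hut, h10, h20]
  · intro y hy
    rw [add_assoc]
    refine (norm_add_le _ _).trans (add_le_add ?_ ((norm_add_le _ _).trans (add_le_add ?_ ?_)))
    · refine (norm_X_mulVec_le _ _ _ _).trans ?_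
      gcongr
      have := hB y (abs_le.1 hy)
      rw [hK]; linarith
    · refine (norm_X_mulVec_le _ _ _ _).trans ?_
      have := he y hy
      have h5 : ε * |s - t| ≤ ε * h := by gcongr
      rw [norm_zero, zero_add]
      exact mul_le_mul (by linarith) (hM y (abs_le.1 hy)) (norm_nonneg _) (by positivity)
    · refine (norm_X_mulVec_le _ _ _ _).trans ?_
      have := hdiff y hy
      exact mul_le_mul (by linarith) (hΔ y hy) (norm_nonneg _) (by positivity)

end Parameters

/-! ### Lax equation for the monodromy matrix and evolution of the Bloch solutions -/

section TimeEvolution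

open Matrix

/-- The matrix of the time part of the modified Lax pair. -/
noncomputable def modTimeMatrix (u : ℝ → ℂ) (z : ℂ) (x : ℝ) : Matrix (Fin 2) (Fin 2) ℂ :=
  U * timeMatrix u z x * U⁻¹

/-- On solutions the system expresses `v_x` and `v_xx` through `v`, which turns the differential
operator into multiplication by a matrix. -/
lemma opAt_eq {u : ℝ → ℂ} (hu : ContDiff ℝ 2 u) {z : ℂ} {ψ : ℝ → Fin 2 → ℂ}
    (hψ : IsModifiedSolution u z ψ) (x : ℝ) : opAt u ψ x = modTimeMatrix u z x *ᵥ ψ x := by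
  have hv := isModifiedSolution_iff.1 hψ
  set v : ℝ → Fin 2 → ℂ := fun x => U⁻¹ *ᵥ ψ x
  have h0 : HasDerivAt u (deriv u x) x := (hu.differentiable (by norm_num) x).hasDerivAt
  have c0 := hasDerivAt_conj h0
  have hd : deriv v = fun y => X u z y *ᵥ v y := funext fun y => (hv y).deriv
  have hv' := hasDerivAt_pi.1 (hv x)
  have hdd : deriv (deriv v) x = X u z x *ᵥ (X u z x *ᵥ v x) + X (deriv u) 0 x *ᵥ v x := by
    rw [hd]
    refine HasDerivAt.deriv ?_
    have v0 := hv' 0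
    have v1 := hv' 1
    simp only [X_mulVec] at v0 v1 ⊢
    rw [hasDerivAt_pi]
    intro i
    fin_cases i
    · refine ((v0.const_mul (-Complex.I * z)).add (h0.mul v1)).congr_deriv ?_
      simp
      ring
    · refine ((c0.neg.mul v0).add (v1.const_mul (Complex.I * z))).congr_deriv ?_
      simp
      ring
  have key : opA u v x = timeMatrix u z x *ᵥ v x := by
    rw [opA, hdd, hd]
    simp only [X_mulVec, timeMatrix_mulVec]
    generalize v x = w
    ext i
    fin_cases i
    · simp [sigma3, offDiag, sq, dotProduct, Fin.sum_univ_two]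
      ring_nf
      simp
      ring
    · simp [sigma3, offDiag, sq, dotProduct, Fin.sum_univ_two]
      ring_nf
      simp
      ring
  change U *ᵥ opA u v x = _
  rw [key, modTimeMatrix]
  simp only [v, mulVec_mulVec, Matrix.mul_assoc]

/-- This is why `α` has its form: it is the first component of `B(0) ψ(0)`, the rate at which the
flow of `B` would violate `ψ₁(0) = 1`. -/
lemma alpha_eq (u : ℝ → ℂ) (L : ℝ) (m z : ℂ) : alpha u L m z =
    modTimeMatrix u z 0 0 0 + modTimeMatrix u z 0 0 1 * psi u L m z 0 1 := by
  have h3 : ((‖u 0‖ : ℝ) : ℂ) ^ 2 = u 0 * (starRingEnd ℂ) (u 0) := by rw [Complex.mul_conj']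
  rw [alpha, modTimeMatrix, U_conj, h3]
  simp [timeMatrix]
  ring_nf
  simp
  ring

lemma modTimeMatrix_period {u : ℝ → ℂ} {L : ℝ} (hper : ∀ x, u (x + L) = u x) (z : ℂ) :
    modTimeMatrix u z L = modTimeMatrix u z 0 := by
  have h0 : u L = u 0 := by simpa using hper 0
  have h1 : deriv u L = deriv u 0 := by
    have := deriv_comp_add_const u L 0
    simpa [hper] using this.symm
  simp only [modTimeMatrix, timeMatrix, h0, h1]

variable {L : ℝ} {I : Set ℝ} {q : ℝ → ℝ → ℂ}

/-- The joint expansion gives analyticity in `z`, the time derivative and, later, the motion of a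
zero depending on both. Only the time coefficient is needed explicitly. -/
lemma IsPeriodicNLSSolution.exists_isLittleO_Yt (hI : I.OrdConnected)
    (hq : IsPeriodicNLSSolution L I q) {t : ℝ} (ht : t ∈ I) (z : ℂ) (x : ℝ) (c : Fin 2 → ℂ) :
    ∃ W : Fin 2 → ℂ, HasDerivAt (fun z => Yt (fun y => q y t) z x *ᵥ c) W z ∧
      (fun p : ℂ × ℝ => Yt (fun y => q y p.2) p.1 x *ᵥ c
      - Yt (fun y => q y t) z x *ᵥ c - ((p.1 - z) • W + ((p.2 - t : ℝ) : ℂ) •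
        (modTimeMatrix (fun y => q y t) z x *ᵥ (Yt (fun y => q y t) z x *ᵥ c) -
          Yt (fun y => q y t) z x *ᵥ (modTimeMatrix (fun y => q y t) z 0 *ᵥ c))))
      =o[𝓝[Set.univ ×ˢ I] (z, t)] fun p => p - (z, t) := by
  have hut := hq.continuous_slice ht
  set u : ℝ → ℂ := fun y => q y t
  set c' := U⁻¹ *ᵥ c with hc'
  have hV := isSolution_Y hut z c'
  have hVc : Continuous fun x => Y u z x *ᵥ c' :=
    continuous_iff_continuousAt.2 fun x => (hV x).continuousAt
  obtain ⟨W₁, h10, h1⟩ := exists_X_solution hut z (f := fun x => X 0 1 x *ᵥ (Y u z x *ᵥ c'))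
    ((by simp only [X, Pi.zero_apply]; fun_prop : Continuous fun x => X 0 1 x).matrix_mulVec hVc) 0
  -- Zero curvature makes `B Y c'` a solution of the linearized equation; subtracting the
  -- homogeneous solution `Y B(0) c'` makes it vanish at `0`.
  have h2 : ∀ x, HasDerivAt (fun x => timeMatrix u z x *ᵥ (Y u z x *ᵥ c') -
      Y u z x *ᵥ (timeMatrix u z 0 *ᵥ c')) (X u z x *ᵥ (timeMatrix u z x *ᵥ (Y u z x *ᵥ c') -
      Y u z x *ᵥ (timeMatrix u z 0 *ᵥ c')) + X (nlsFlow u) 0 x *ᵥ (Y u z x *ᵥ c')) x := by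
    intro x
    refine ((hasDerivAt_timeMatrix_mulVec (hq.contDiff t ht) hV x).sub
      (isSolution_Y hut z (timeMatrix u z 0 *ᵥ c') x)).congr_deriv ?_
    rw [mulVec_sub]
    abel
  have key := hq.isLittleO_solution hI ht z c' h10
    (by simp only [Y_zero hut, one_mulVec, sub_self]) h1 h2 x
  suffices hmain : (fun p : ℂ × ℝ => Yt (fun y => q y p.2) p.1 x *ᵥ c - Yt u z x *ᵥ c
      - ((p.1 - z) • (U *ᵥ W₁ x) + ((p.2 - t : ℝ) : ℂ) •
        (modTimeMatrix u z x *ᵥ (Yt u z x *ᵥ c) - Yt u z x *ᵥ (modTimeMatrix u z 0 *ᵥ c))))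
      =o[𝓝[Set.univ ×ˢ I] (z, t)] fun p => p - (z, t) by
    refine ⟨U *ᵥ W₁ x, ?_, hmain⟩
    have htend : Tendsto (fun z' : ℂ => (z', t)) (𝓝 z) (𝓝[Set.univ ×ˢ I] (z, t)) :=
      tendsto_nhdsWithin_iff.2 ⟨by
        have : Continuous fun z' : ℂ => (z', t) := by fun_prop
        exact this.tendsto z, .of_forall fun z' => ⟨trivial, ht⟩⟩
    rw [hasDerivAt_iff_isLittleO]
    refine ((hmain.comp_tendsto htend).congr_left fun z' => ?_).trans_isBigO ?_
    · simp only [Function.comp_apply, sub_self, Complex.ofReal_zero, zero_smul, add_zero]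
      rfl
    · refine .of_bound 1 (.of_forall fun z' => ?_)
      simp [Prod.norm_def]
  have hU := (LinearMap.toContinuousLinearMap U.mulVecLin).isBigO_comp
    (fun p : ℂ × ℝ => Y (fun y => q y p.2) p.1 x *ᵥ c' - Y u z x *ᵥ c' - ((p.1 - z) • W₁ x +
      ((p.2 - t : ℝ) : ℂ) • (timeMatrix u z x *ᵥ (Y u z x *ᵥ c') -
      Y u z x *ᵥ (timeMatrix u z 0 *ᵥ c')))) (𝓝[Set.univ ×ˢ I] (z, t))
  refine (hU.trans_isLittleO key).congr_left fun p => ?_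
  change U *ᵥ _ = _
  simp only [mulVec_sub, mulVec_add, mulVec_smul, Yt, modTimeMatrix, hc']
  simp only [mulVec_mulVec, ← Matrix.mul_assoc]
  simp only [Matrix.mul_assoc _ U⁻¹ U, U_inv_mul_U, Matrix.mul_one]

lemma IsPeriodicNLSSolution.differentiable_Yt (hI : I.OrdConnected)
    (hq : IsPeriodicNLSSolution L I q) {t : ℝ} (ht : t ∈ I) (x : ℝ) (i j : Fin 2) :
    Differentiable ℂ fun z => Yt (fun y => q y t) z x i j := by
  intro z
  obtain ⟨W, hW, -⟩ := hq.exists_isLittleO_Yt hI ht z x (Pi.single j 1)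
  simpa using (hasDerivAt_pi.1 hW i).differentiableAt

lemma IsPeriodicNLSSolution.hasDerivWithinAt_Yt (hI : I.OrdConnected)
    (hq : IsPeriodicNLSSolution L I q) {t : ℝ} (ht : t ∈ I) (z : ℂ) (x : ℝ) (c : Fin 2 → ℂ) :
    HasDerivWithinAt (fun s => Yt (fun y => q y s) z x *ᵥ c)
      (modTimeMatrix (fun y => q y t) z x *ᵥ (Yt (fun y => q y t) z x *ᵥ c) -
        Yt (fun y => q y t) z x *ᵥ (modTimeMatrix (fun y => q y t) z 0 *ᵥ c)) I t := by
  obtain ⟨W, -, hW⟩ := hq.exists_isLittleO_Yt hI ht z x c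
  have htend : Tendsto (fun s : ℝ => (z, s)) (𝓝[I] t) (𝓝[Set.univ ×ˢ I] (z, t)) :=
    tendsto_nhdsWithin_iff.2 ⟨by
      have : Continuous fun s : ℝ => (z, s) := by fun_prop
      exact (this.tendsto t).mono_left nhdsWithin_le_nhds,
      eventually_mem_nhdsWithin.mono fun s hs => ⟨trivial, hs⟩⟩
  rw [hasDerivWithinAt_iff_isLittleO]
  refine ((hW.comp_tendsto htend).congr_left fun s => ?_).trans_isBigO ?_
  · simp only [Function.comp_apply, sub_self, zero_smul, zero_add, Complex.coe_smul]
  · refine .of_bound 1 (.of_forall fun z' => ?_)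
    simp [Prod.norm_def]

/-- Periodicity gives `B(L) = B(0)`, so the time derivative becomes a commutator: the Lax equation.
-/
lemma IsPeriodicNLSSolution.hasDerivWithinAt_monodromy (hI : I.OrdConnected)
    (hq : IsPeriodicNLSSolution L I q) {t : ℝ} (ht : t ∈ I) (z : ℂ) (i j : Fin 2) :
    HasDerivWithinAt (fun s => Yt (fun y => q y s) z L i j)
      ((modTimeMatrix (fun y => q y t) z 0 * Yt (fun y => q y t) z L -
        Yt (fun y => q y t) z L * modTimeMatrix (fun y => q y t) z 0) i j) I t := by
  have h := hasDerivWithinAt_pi.1 (hq.hasDerivWithinAt_Yt hI ht z L (Pi.single j 1)) i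
  rw [modTimeMatrix_period (hq.periodic t ht)] at h
  simp only [mulVec_mulVec, ← sub_mulVec] at h
  simpa only [mulVec_single_one] using! h

/-- A commutator has trace zero. This is what lets a multiplier chosen at one time serve at all
times. -/
lemma IsPeriodicNLSSolution.Delta_eq (hI : I.OrdConnected)
    (hq : IsPeriodicNLSSolution L I q) {t s : ℝ} (ht : t ∈ I) (hs : s ∈ I) (z : ℂ) :
    Delta (fun y => q y t) L z = Delta (fun y => q y s) L z := by
  have hd : ∀ r ∈ I, HasDerivWithinAt (fun r => (Yt (fun y => q y r) z L).trace) 0 I r := by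
    intro r hr
    simp only [trace_fin_two]
    refine ((hq.hasDerivWithinAt_monodromy hI hr z 0 0).add
      (hq.hasDerivWithinAt_monodromy hI hr z 1 1)).congr_deriv ?_
    simp [mul_apply, Fin.sum_univ_two]
    ring
  have := hI.convex.norm_image_sub_le_of_norm_hasDerivWithin_le (C := 0) hd (by simp) hs ht
  rw [zero_mul, norm_le_zero_iff, sub_eq_zero] at this
  rw [Delta, Delta, ← trace_Yt, ← trace_Yt, this]

/-- The Bloch–Floquet solutions evolve by the modified Lax pair, up to normalization. -/
lemma IsPeriodicNLSSolution.hasDerivWithinAt_psi (hI : I.OrdConnected)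
    (hq : IsPeriodicNLSSolution L I q) {t : ℝ} (ht : t ∈ I) {m z : ℂ}
    (hm : m ^ 2 - 2 * Delta (fun y => q y t) L z * m + 1 = 0)
    (hbf : BFDefined (fun y => q y t) L m z) (x : ℝ) :
    HasDerivWithinAt (fun s => psi (fun y => q y s) L m z x)
        (opAt (fun y => q y t) (psi (fun y => q y t) L m z) x
          - alpha (fun y => q y t) L m z • psi (fun y => q y t) L m z x) I t := by
  have hct := hq.continuous_slice ht
  have hne := hbf.ne_or_ne hct (hq.periodic t ht)
  have hM := hq.hasDerivWithinAt_monodromy hI ht z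
  have hpsi : ∀ s ∈ I, (Yt (fun y => q y s) z L 0 1 ≠ 0 ∨ Yt (fun y => q y s) z L 1 1 ≠ m) →
      ∃ w, Yt (fun y => q y s) z L *ᵥ ![1, w] = m • ![1, w] ∧
        psi (fun y => q y s) L m z = fun x => Yt (fun y => q y s) z x *ᵥ ![1, w] := by
    intro s hs hns
    have hcs := hq.continuous_slice hs
    obtain ⟨w, hw⟩ := exists_eigenvector hcs (by rwa [hq.Delta_eq hI hs ht]) hns
    exact ⟨w, hw, (bfDefined_and_psi_eq hcs (hq.periodic s hs) hns hw).2⟩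
  obtain ⟨w, hw, hψ⟩ := hpsi t ht hne
  have hw12 := mulVec_one_eq_smul_iff.1 hw
  set B := modTimeMatrix (fun y => q y t) z 0 with hB
  set M := Yt (fun y => q y t) z L with hMdef
  -- `W s` is the second initial component of `ψ` at time `s`. Whichever row of the eigenvector
  -- equation is solvable at `t` stays so nearby, and the Lax equation gives the same Riccati
  -- derivative in both cases.
  obtain ⟨W, hWt, hWψ, hWd⟩ : ∃ W : ℝ → ℂ, W t = w ∧
      (∀ᶠ s in 𝓝[I] t, psi (fun y => q y s) L m z = fun x => Yt (fun y => q y s) z x *ᵥ ![1, W s])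
      ∧ HasDerivWithinAt W (B 1 0 + B 1 1 * w - (B 0 0 + B 0 1 * w) * w) I t := by
    rcases hne with hb | hd
    · have hwt : (m - M 0 0) / M 0 1 = w := by
        rw [div_eq_iff hb]; linear_combination -hw12.1
      refine ⟨fun s => (m - Yt (fun y => q y s) z L 0 0) / Yt (fun y => q y s) z L 0 1, hwt, ?_, ?_⟩
      · filter_upwards [(hM 0 1).continuousWithinAt.eventually_ne hb, self_mem_nhdsWithin]
          with s hs hsI
        obtain ⟨w', hw', h'⟩ := hpsi s hsI (Or.inl hs)
        rw [h']
        have := (mulVec_one_eq_smul_iff.1 hw').1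
        have : (m - Yt (fun y => q y s) z L 0 0) / Yt (fun y => q y s) z L 0 1 = w' := by
          rw [div_eq_iff hs]; linear_combination -this
        rw [this]
      · refine (((hM 0 0).const_sub m).fun_div (hM 0 1) hb).congr_deriv ?_
        rw [← hMdef] at *
        rw [div_eq_iff (pow_ne_zero 2 hb)]
        simp only [Matrix.sub_apply, mul_apply, Fin.sum_univ_two]
        have e1 : m - M 0 0 = M 0 1 * w := by linear_combination -hw12.1
        rw [e1]
        linear_combination (-(M 0 1) * B 0 1) * hw12.2 + (M 0 1 * B 0 1 * w) * hw12.1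
    · have hd' : m - M 1 1 ≠ 0 := sub_ne_zero.2 (Ne.symm hd)
      have hwt : M 1 0 / (m - M 1 1) = w := by
        rw [div_eq_iff hd']; linear_combination hw12.2
      refine ⟨fun s => Yt (fun y => q y s) z L 1 0 / (m - Yt (fun y => q y s) z L 1 1), hwt, ?_, ?_⟩
      · filter_upwards [(hM 1 1).continuousWithinAt.eventually_ne hd, self_mem_nhdsWithin]
          with s hs hsI
        obtain ⟨w', hw', h'⟩ := hpsi s hsI (Or.inr hs)
        rw [h']
        have := (mulVec_one_eq_smul_iff.1 hw').2
        have : Yt (fun y => q y s) z L 1 0 / (m - Yt (fun y => q y s) z L 1 1) = w' := by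
          rw [div_eq_iff (sub_ne_zero.2 (Ne.symm hs))]; linear_combination this
        rw [this]
      · refine ((hM 1 0).fun_div ((hM 1 1).const_sub m) hd').congr_deriv ?_
        rw [← hMdef] at *
        rw [div_eq_iff (pow_ne_zero 2 hd')]
        simp only [Matrix.sub_apply, mul_apply, Fin.sum_univ_two]
        have e1 : M 1 0 = (m - M 1 1) * w := by linear_combination hw12.2
        rw [e1]
        linear_combination ((m - M 1 1) * B 1 0) * hw12.1
  have hD0 := hq.hasDerivWithinAt_Yt hI ht z x ![1, 0]
  have hD1 := hq.hasDerivWithinAt_Yt hI ht z x ![0, 1]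
  have hsplit : ∀ (A : Matrix (Fin 2) (Fin 2) ℂ) (r : ℂ),
      A *ᵥ ![1, r] = A *ᵥ ![1, 0] + r • A *ᵥ ![0, 1] := by
    intro A r
    rw [← mulVec_smul, ← mulVec_add]
    simp
  have hfinal := hD0.add (hWd.smul hD1)
  refine (hfinal.congr_of_eventuallyEq ?_ ?_).congr_deriv ?_
  · filter_upwards [hWψ] with s hs
    rw [hs]
    exact hsplit _ _
  · rw [hψ]
    rw [Pi.add_apply, Pi.smul_apply', hWt]
    exact hsplit _ _
  · rw [opAt_eq (hq.contDiff t ht) (z := z) (by rw [hψ]; exact isModifiedSolution_Yt hct z _),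
      alpha_eq, hψ, ← hB]
    simp only [Yt_zero hct, one_mulVec, hWt]
    rw [show (![1, w] : Fin 2 → ℂ) 1 = w from rfl]
    -- That is, `B(0)(1,w) = α (1,w) + w_t (0,1)`: the extra term from the moving initial vector
    -- combines with `-Yt B(0)(1,w)` to leave `-α ψ`.
    have hα : (B 0 0 + B 0 1 * w) • ![1, w] = B *ᵥ ![1, w] -
        (B 1 0 + B 1 1 * w - (B 0 0 + B 0 1 * w) * w) • ![0, 1] := by
      ext i
      fin_cases i <;> simp
    rw [← mulVec_smul _ (B 0 0 + B 0 1 * w), hα, mulVec_sub, mulVec_smul, hsplit (Yt _ z x) w, hsplit B w]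
    simp only [mulVec_add, mulVec_smul, smul_sub]
    abel

end TimeEvolution

/-! ### Asymptotics of `α` in nontangential sectors -/

section Asymptotics

open Matrix

variable {u : ℝ → ℂ} {L : ℝ}

/-- Second-order asymptotics, uniform in `κ`, of a bounded periodic solution of a Riccati equation
with large linear coefficient. -/
lemma riccati_periodic_bound (hL : 0 < L) {f a a' a'' b : ℝ → ℂ} {κ : ℂ} {K : ℝ} (hK : 1 ≤ K)
    (hf : ∀ x, HasDerivAt f (κ * f x + a x + b x * f x ^ 2) x)
    (ha : ∀ x, HasDerivAt a (a' x) x) (ha' : ∀ x, HasDerivAt a' (a'' x) x)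
    (hfp : ∀ x, f (x + L) = f x) (hap : ∀ x, a (x + L) = a x) (hap' : ∀ x, a' (x + L) = a' x)
    (bf : ∀ x, ‖f x‖ ≤ 1) (ba : ∀ x, ‖a x‖ ≤ K) (ba' : ∀ x, ‖a' x‖ ≤ K) (ba'' : ∀ x, ‖a'' x‖ ≤ K)
    (bb : ∀ x, ‖b x‖ ≤ K) (hκ : 4 * K ≤ |κ.re|) (x : ℝ) :
    ‖f x + a x / κ + a' x / κ ^ 2‖ ≤ 2 * (K + 4 * K ^ 3) / (‖κ‖ ^ 2 * |κ.re|) := by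
  have hκn : 4 * K ≤ ‖κ‖ := hκ.trans (Complex.abs_re_le_norm κ)
  have hκ0 : κ ≠ 0 := by
    rintro rfl
    simp at hκn; linarith
  have hκp : 0 < ‖κ‖ := norm_pos_iff.2 hκ0
  have hre : 0 < |κ.re| := by linarith
  -- The two-term formal solution: `g' = κ g + a - a''/κ²`, so it misses the Riccati equation only
  -- by `r` below.
  set g : ℝ → ℂ := fun x => -(a x / κ) - a' x / κ ^ 2 with hg
  set d : ℝ → ℂ := fun x => f x - g x with hd
  have hdx : ∀ x, f x + a x / κ + a' x / κ ^ 2 = d x := fun x => by rw [hd, hg]; ring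
  have bg : ∀ x, ‖g x‖ ≤ 2 * K / ‖κ‖ := by
    intro x
    have h1 : ‖a x / κ‖ ≤ K / ‖κ‖ := by rw [norm_div]; gcongr; exact ba x
    have h2 : ‖a' x / κ ^ 2‖ ≤ K / ‖κ‖ := by
      rw [norm_div, norm_pow]
      refine div_le_div₀ (by linarith) (ba' x) hκp ?_
      nlinarith
    calc ‖g x‖ ≤ ‖-(a x / κ)‖ + ‖a' x / κ ^ 2‖ := norm_sub_le _ _
      _ ≤ K / ‖κ‖ + K / ‖κ‖ := by rw [norm_neg]; gcongr
      _ = _ := by ring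
  have bg1 : ∀ x, ‖g x‖ ≤ 1 := fun x => (bg x).trans (by rw [div_le_one hκp]; linarith)
  set r : ℝ → ℂ := fun x => a'' x / κ ^ 2 + b x * g x ^ 2 with hr
  have br : ∀ x, ‖r x‖ ≤ (K + 4 * K ^ 3) / ‖κ‖ ^ 2 := by
    intro x
    calc ‖r x‖ ≤ ‖a'' x / κ ^ 2‖ + ‖b x * g x ^ 2‖ := norm_add_le _ _
      _ ≤ K / ‖κ‖ ^ 2 + K * (2 * K / ‖κ‖) ^ 2 := by
        rw [norm_div, norm_pow, norm_mul, norm_pow]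
        gcongr
        · exact ba'' x
        · exact bb x
        · exact bg x
      _ = _ := by field_simp; ring
  have hdd : ∀ x, HasDerivAt d (κ * d x + b x * (f x + g x) * d x + r x) x := by
    intro x
    have hg' : HasDerivAt g (-(a' x / κ) - a'' x / κ ^ 2) x :=
      ((ha x).div_const κ).neg.sub ((ha' x).div_const _)
    refine ((hf x).sub hg').congr_deriv ?_
    simp only [hd, hr, hg]
    field_simp
    ring
  have hdp : Function.Periodic d L := fun x => by simp only [hd, hg, hfp, hap, hap']
  have hdc : Continuous fun x => ‖d x‖ :=
    (continuous_iff_continuousAt.2 fun x => (hdd x).continuousAt).norm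
  -- Maximum principle: at a maximum of `‖d‖` over a period the derivative of `‖d‖²` vanishes, so
  -- `Re κ ‖d‖²` is balanced by the error terms. The sign of `Re κ` plays no role.
  obtain ⟨x₀, -, hx₀⟩ := (isCompact_Icc (a := 0) (b := L)).exists_isMaxOn
    (Set.nonempty_Icc.2 hL.le) hdc.continuousOn
  have hmax : ∀ y, ‖d y‖ ≤ ‖d x₀‖ := by
    intro y
    obtain ⟨y', hy', hyy⟩ := hdp.exists_mem_Ico₀ hL y
    rw [hyy]
    exact hx₀ (Set.Ico_subset_Icc_self hy')
  rw [hdx]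
  refine (hmax x).trans ?_
  rcases eq_or_ne (d x₀) 0 with h0 | h0
  · rw [h0, norm_zero]; positivity
  have hn0 : 0 < ‖d x₀‖ := norm_pos_iff.2 h0
  have hcrit := (IsLocalMax.hasDerivAt_eq_zero (f := fun y => ‖d y‖ ^ 2) (a := x₀)
    (.of_forall fun y => by have := hmax y; dsimp only; gcongr) (hdd x₀).norm_sq)
  rw [Complex.inner] at hcrit
  set e := b x₀ * (f x₀ + g x₀) * d x₀ + r x₀ with he
  have hsplit : (κ * d x₀ + b x₀ * (f x₀ + g x₀) * d x₀ + r x₀) * (starRingEnd ℂ) (d x₀) =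
      κ * ((‖d x₀‖ ^ 2 : ℝ) : ℂ) + e * (starRingEnd ℂ) (d x₀) := by
    have := Complex.mul_conj' (d x₀)
    push_cast
    rw [he, ← this]; ring
  have hz : κ.re * ‖d x₀‖ ^ 2 = -(e * (starRingEnd ℂ) (d x₀)).re := by
    have h2 : ((κ * d x₀ + b x₀ * (f x₀ + g x₀) * d x₀ + r x₀) * (starRingEnd ℂ) (d x₀)).re = 0 := by
      linarith
    rw [hsplit, Complex.add_re, Complex.re_mul_ofReal] at h2
    linarith
  have hbe : ‖e‖ ≤ K * 2 * ‖d x₀‖ + (K + 4 * K ^ 3) / ‖κ‖ ^ 2 := by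
    refine (norm_add_le _ _).trans (add_le_add ?_ (br x₀))
    rw [norm_mul, norm_mul]
    gcongr
    · exact bb x₀
    · exact (norm_add_le _ _).trans (by linarith [bf x₀, bg1 x₀])
  have h1 : |κ.re| * ‖d x₀‖ ^ 2 ≤ ‖e‖ * ‖d x₀‖ := by
    have := congrArg abs hz
    rw [abs_mul, abs_neg, abs_of_nonneg (sq_nonneg ‖d x₀‖)] at this
    rw [this]
    refine (Complex.abs_re_le_norm _).trans ?_
    rw [norm_mul, RCLike.norm_conj]
  have h2 : |κ.re| * ‖d x₀‖ ≤ ‖e‖ := by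
    refine le_of_mul_le_mul_right ?_ hn0
    linarith
  -- The hypothesis `4 * K ≤ |κ.re|` absorbs the term `2 * K * ‖d x₀‖` into half of the left side.
  have h3 : |κ.re| * ‖d x₀‖ ≤ 2 * ((K + 4 * K ^ 3) / ‖κ‖ ^ 2) := by nlinarith
  rw [le_div_iff₀ (by positivity)]
  have h4 : 2 * ((K + 4 * K ^ 3) / ‖κ‖ ^ 2) * ‖κ‖ ^ 2 = 2 * (K + 4 * K ^ 3) := by
    field_simp
  nlinarith [mul_le_mul_of_nonneg_right h3 (sq_nonneg ‖κ‖)]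

/-- Off a horizontal strip the indefinite energy of a nontrivial solution is monotone. -/
lemma IsSolution.strictMono_energy (hu : Continuous u) {K : ℝ} (hK : ∀ x, ‖u x‖ ≤ K) {z : ℂ}
    (hz : K < |z.im|) {v : ℝ → Fin 2 → ℂ} (hv : IsSolution u z v) (hv0 : v 0 ≠ 0) :
    StrictMono fun x => z.im * (‖v x 0‖ ^ 2 - ‖v x 1‖ ^ 2) := by
  have hne : ∀ x, v x ≠ 0 := by
    intro x hx
    rw [hv.eq_Y hu x] at hx
    exact hv0 (eq_zero_of_mulVec_eq_zero (by rw [det_Y hu]; exact one_ne_zero) hx)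
  have hd : ∀ x, HasDerivAt (fun x => z.im * (‖v x 0‖ ^ 2 - ‖v x 1‖ ^ 2))
      (z.im * (2 * z.im * (‖v x 0‖ ^ 2 + ‖v x 1‖ ^ 2) +
        4 * (u x * v x 1 * (starRingEnd ℂ) (v x 0)).re)) x := by
    intro x
    have h := hasDerivAt_pi.1 (hv x)
    have h0 := h 0
    have h1 := h 1
    rw [X_mulVec] at h0 h1
    refine ((h0.norm_sq.sub h1.norm_sq).const_mul z.im).congr_deriv ?_
    simp only [Complex.inner, ← Complex.normSq_eq_norm_sq, Complex.normSq_apply]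
    congr 1
    simp
    ring
  refine strictMono_of_deriv_pos fun x => ?_
  rw [(hd x).deriv]
  have hpos : 0 < ‖v x 0‖ ^ 2 + ‖v x 1‖ ^ 2 := by
    by_contra! hcon
    have e0 : ‖v x 0‖ = 0 := by nlinarith [sq_nonneg ‖v x 0‖, sq_nonneg ‖v x 1‖]
    have e1 : ‖v x 1‖ = 0 := by nlinarith [sq_nonneg ‖v x 0‖, sq_nonneg ‖v x 1‖]
    refine hne x (funext fun i => ?_)
    fin_cases i
    · exact norm_eq_zero.1 e0
    · exact norm_eq_zero.1 e1
  -- The cross term costs at most `2 K |Im z| S` against the diagonal `2 (Im z)² S`, with `S` the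
  -- squared Euclidean norm of `v x`; this is where `K < |Im z|` enters.
  have hb : |(u x * v x 1 * (starRingEnd ℂ) (v x 0)).re| ≤ K * (‖v x 0‖ * ‖v x 1‖) := by
    refine (Complex.abs_re_le_norm _).trans ?_
    rw [norm_mul, norm_mul, RCLike.norm_conj, mul_assoc, mul_comm ‖v x 1‖]
    gcongr
    exact hK x
  have hz0 : 0 < |z.im| := lt_of_le_of_lt ((norm_nonneg _).trans (hK 0)) hz
  set S := ‖v x 0‖ ^ 2 + ‖v x 1‖ ^ 2 with hS
  have hab : 2 * (‖v x 0‖ * ‖v x 1‖) ≤ S := by nlinarith [sq_nonneg (‖v x 0‖ - ‖v x 1‖)]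
  set P := (u x * v x 1 * (starRingEnd ℂ) (v x 0)).re
  have hK0 : 0 ≤ K := (norm_nonneg _).trans (hK 0)
  have h5 : 2 * |P| ≤ K * S := by nlinarith
  have h6 : -(|z.im| * |P|) ≤ z.im * P := by rw [← abs_mul]; exact neg_abs_le _
  have h7 : z.im * z.im = |z.im| * |z.im| := (abs_mul_abs_self _).symm
  have h8 : 2 * (|z.im| * |P|) ≤ |z.im| * (K * S) := by nlinarith
  have h9 : |z.im| * (K * S) < |z.im| * (|z.im| * S) := by gcongr
  nlinarith

/-- A multiplier of modulus one would make the strictly increasing energy periodic. -/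
lemma not_mem_laxSpectrum_of_lt_abs_im (hu : Continuous u) (hper : ∀ x, u (x + L) = u x)
    (hL : 0 < L) {K : ℝ} (hK : ∀ x, ‖u x‖ ≤ K) {z : ℂ} (hz : K < |z.im|) : z ∉ laxSpectrum u := by
  rw [mem_laxSpectrum_iff hu hper hL]
  rintro ⟨m, hm1, hm⟩
  obtain ⟨v, hv, hv0, hvm⟩ := exists_multiplicative_solution hu hper hm
  have := hv.strictMono_energy hu hK hz hv0 hL
  have hvL := hvm 0
  rw [zero_add] at hvL
  simp [hvL, hm1] at this

lemma U_inv_mulVec (ψ : Fin 2 → ℂ) : U⁻¹ *ᵥ ψ =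
    ((Real.sqrt 2 : ℝ) : ℂ)⁻¹ • ![ψ 0 + Complex.I * ψ 1, ψ 0 - Complex.I * ψ 1] := by
  rw [U_inv, smul_mulVec]
  congr 1
  ext i
  fin_cases i <;> simp [mulVec, dotProduct, Fin.sum_univ_two]
  ring

/-- The Dirichlet condition forces `|v₁| = |v₂|`, so the strictly increasing energy would vanish at
both ends. -/
lemma not_mem_dirichletSpectrum_of_lt_abs_im (hu : Continuous u) (hL : 0 < L) {K : ℝ}
    (hK : ∀ x, ‖u x‖ ≤ K) {z : ℂ} (hz : K < |z.im|) : z ∉ dirichletSpectrum u L := by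
  rw [mem_dirichletSpectrum_iff hu hL]
  intro h
  have hψ := isModifiedSolution_iff.1 (isModifiedSolution_Yt hu z ![0, 1])
  have h0 : (Yt u z 0 *ᵥ ![0, 1]) 0 = 0 := by simp [Yt_zero hu]
  have hL0 : (Yt u z L *ᵥ ![0, 1]) 0 = 0 := by simp [mulVec, dotProduct, Fin.sum_univ_two, h]
  have := hψ.strictMono_energy hu hK hz ?_ hL
  · simp only [U_inv_mulVec, h0, hL0] at this
    simp at this
  · intro h
    simp only [U_inv_mulVec, Yt_zero hu, one_mulVec] at h
    have := congrFun h 0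
    simp at this

/-- Bounds the right sides of the two identities `one_add_mul_alpha_sub` and
`one_add_mul_alpha_add`: every summand is `O(1/z)`. -/
lemma norm_remainder_le {x x' c y d k z : ℂ} {K C : ℝ} (hK : 1 ≤ K) (hz : 1 ≤ ‖z‖)
    (hx : ‖x‖ ≤ K) (hx' : ‖x'‖ ≤ K) (hc : ‖c‖ ≤ K) (hy : ‖y‖ ≤ 2 * K ^ 2) (hk : ‖k‖ ≤ 4)
    (hd : ‖d‖ ≤ C / ‖z‖ ^ 3) :
    ‖x / (2 * Complex.I * z) * y + x' / (4 * z ^ 2) * (2 * z * c + y)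
      + d * (k * z ^ 2 + 2 * z * c + y)‖ ≤
      (2 * K ^ 3 + K ^ 2 + C * (4 + 2 * K + 2 * K ^ 2)) / ‖z‖ := by
  have hzp : 0 < ‖z‖ := by linarith
  have hC : 0 ≤ C := by
    have := (norm_nonneg _).trans hd
    by_contra! hC
    exact absurd this (not_le.2 (div_neg_of_neg_of_pos hC (by positivity)))
  have hK0 : 0 ≤ K := by linarith
  have h1 : ‖x / (2 * Complex.I * z) * y‖ ≤ K ^ 3 / ‖z‖ := by
    rw [norm_mul, norm_div, norm_mul, norm_mul, Complex.norm_I, Complex.norm_ofNat, mul_one]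
    calc ‖x‖ / (2 * ‖z‖) * ‖y‖ ≤ K / (2 * ‖z‖) * (2 * K ^ 2) := by gcongr
      _ = K ^ 3 / ‖z‖ := by field_simp
  have hb : ‖2 * z * c + y‖ ≤ (2 * K + 2 * K ^ 2) * ‖z‖ := by
    refine (norm_add_le _ _).trans ?_
    rw [norm_mul, norm_mul, Complex.norm_ofNat]
    have e1 : 2 * ‖z‖ * ‖c‖ ≤ 2 * ‖z‖ * K := by gcongr
    nlinarith [sq_nonneg K]
  have h2 : ‖x' / (4 * z ^ 2) * (2 * z * c + y)‖ ≤ (K ^ 2 + K ^ 3) / ‖z‖ := by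
    rw [norm_mul, norm_div, norm_mul, norm_pow, Complex.norm_ofNat]
    calc ‖x'‖ / (4 * ‖z‖ ^ 2) * ‖2 * z * c + y‖
        ≤ K / (4 * ‖z‖ ^ 2) * ((2 * K + 2 * K ^ 2) * ‖z‖) := by gcongr
      _ = (K ^ 2 + K ^ 3) / ‖z‖ / 2 := by field_simp; ring
      _ ≤ (K ^ 2 + K ^ 3) / ‖z‖ := half_le_self (by positivity)
  have h3 : ‖d * (k * z ^ 2 + 2 * z * c + y)‖ ≤ C * (4 + 2 * K + 2 * K ^ 2) / ‖z‖ := by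
    have e1 : ‖k * z ^ 2 + 2 * z * c + y‖ ≤ (4 + 2 * K + 2 * K ^ 2) * ‖z‖ ^ 2 := by
      rw [add_assoc]
      refine (norm_add_le _ _).trans ?_
      rw [norm_mul, norm_pow]
      have e2 : ‖k‖ * ‖z‖ ^ 2 ≤ 4 * ‖z‖ ^ 2 := by gcongr
      have e3 : (2 * K + 2 * K ^ 2) * ‖z‖ ≤ (2 * K + 2 * K ^ 2) * ‖z‖ ^ 2 := by
        gcongr
        nlinarith
      linarith
    rw [norm_mul]
    calc ‖d‖ * ‖k * z ^ 2 + 2 * z * c + y‖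
        ≤ C / ‖z‖ ^ 3 * ((4 + 2 * K + 2 * K ^ 2) * ‖z‖ ^ 2) := by gcongr
      _ = _ := by field_simp
  calc _ ≤ K ^ 3 / ‖z‖ + (K ^ 2 + K ^ 3) / ‖z‖ + C * (4 + 2 * K + 2 * K ^ 2) / ‖z‖ :=
        (norm_add_le _ _).trans (add_le_add ((norm_add_le _ _).trans (add_le_add h1 h2)) h3)
    _ = _ := by ring

lemma norm_le_of_one_add_mul_eq {p e w : ℂ} {B : ℝ} (hp : ‖p‖ ≤ 1 / 2) (he : ‖e‖ ≤ B)
    (h : (1 + p) * w = e) : ‖w‖ ≤ 2 * B := by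
  have h1 : 1 / 2 ≤ ‖1 + p‖ := by
    have := norm_sub_norm_le (1 : ℂ) (-p)
    rw [norm_neg, sub_neg_eq_add, norm_one] at this
    linarith
  have h2 : ‖1 + p‖ * ‖w‖ ≤ B := by rw [← norm_mul, h]; exact he
  nlinarith [norm_nonneg w]

/-- Here `a, a'` stand for `q, q_x`, `b, b'` for their conjugates, `p` for `v₁/v₂` and `w` for `ψ₂`,
all at `x = 0`. Multiplication by `1 + p` clears the denominator of `w`; the two-term expansion of
`p` then cancels the nondecaying orders. -/
lemma one_add_mul_alpha_sub {a a' b b' d p w z : ℂ} (hz : z ≠ 0)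
    (hp : p = a / (2 * Complex.I * z) + a' / (4 * z ^ 2) + d)
    (hw : (1 + p) * w = Complex.I * (1 - p)) :
    (1 + p) * (z * (a - b) + Complex.I / 2 * (a' + b') + (2 * z ^ 2 - Complex.I * z * (b + a) -
      a * b + 1 / 2 * a' - 1 / 2 * b') * w - 2 * Complex.I * z ^ 2) =
    a / (2 * Complex.I * z) * (Complex.I * (b' + a * b)) + a' / (4 * z ^ 2) *
      (2 * z * -b + Complex.I * (b' + a * b)) +
      d * (-4 * Complex.I * z ^ 2 + 2 * z * -b + Complex.I * (b' + a * b)) := by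
  -- Solving for `a` and `a'` makes the identity polynomial, and with `I` a free variable only `I² =
  -- -1` is used.
  obtain ⟨P, hP⟩ : ∃ P, P = a / (2 * Complex.I * z) := ⟨_, rfl⟩
  obtain ⟨P', hP'⟩ : ∃ P', P' = a' / (4 * z ^ 2) := ⟨_, rfl⟩
  have ha : a = 2 * Complex.I * z * P := by rw [hP]; field_simp
  have ha' : a' = 4 * z ^ 2 * P' := by rw [hP']; field_simp
  rw [← hP, ← hP'] at hp ⊢
  clear hP hP'
  subst ha ha' hp
  have hI := Complex.I_sq
  generalize Complex.I = i at *
  linear_combination (2 * z ^ 2 - i * z * (b + 2 * i * z * P) - 2 * i * z * P * b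
    + 1 / 2 * (4 * z ^ 2 * P') - 1 / 2 * b') * hw
    + z * (2 * i * P * z * (P + P' + d - 1) + b * (P' + d - P - 1)) * hI

/-- The mirror case, with `p` standing for `v₂/v₁`. -/
lemma one_add_mul_alpha_add {a a' b b' d p w z : ℂ} (hz : z ≠ 0)
    (hp : p = b / (2 * Complex.I * z) + -b' / (4 * z ^ 2) + d)
    (hw : (1 + p) * w = Complex.I * (p - 1)) :
    (1 + p) * (z * (a - b) + Complex.I / 2 * (a' + b') + (2 * z ^ 2 - Complex.I * z * (b + a) -
      a * b + 1 / 2 * a' - 1 / 2 * b') * w + 2 * Complex.I * z ^ 2) =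
    b / (2 * Complex.I * z) * (Complex.I * (a' - a * b)) + -b' / (4 * z ^ 2) *
      (2 * z * a + Complex.I * (a' - a * b)) +
      d * (4 * Complex.I * z ^ 2 + 2 * z * a + Complex.I * (a' - a * b)) := by
  obtain ⟨P, hP⟩ : ∃ P, P = b / (2 * Complex.I * z) := ⟨_, rfl⟩
  obtain ⟨P', hP'⟩ : ∃ P', P' = -b' / (4 * z ^ 2) := ⟨_, rfl⟩
  have ha : b = 2 * Complex.I * z * P := by rw [hP]; field_simp
  have ha' : b' = -(4 * z ^ 2 * P') := by rw [hP']; field_simp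
  rw [← hP, ← hP'] at hp ⊢
  clear hP hP'
  subst ha ha' hp
  have hI := Complex.I_sq
  generalize Complex.I = i at *
  linear_combination (2 * z ^ 2 - i * z * (a + 2 * i * z * P) - 2 * i * z * P * a
    + 1 / 2 * (4 * z ^ 2 * P') + 1 / 2 * a') * hw
    - z * (2 * i * P * z * (P + P' + d - 1) + a * (P' + d - P - 1)) * hI

lemma exists_C2_periodic_bound (hu : ContDiff ℝ 2 u) (hper : ∀ x, u (x + L) = u x) (hL : 0 < L) :
    ∃ K, 1 ≤ K ∧ (∀ x, ‖u x‖ ≤ K) ∧ (∀ x, ‖deriv u x‖ ≤ K) ∧ ∀ x, ‖deriv (deriv u) x‖ ≤ K := by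
  have key : ∀ f : ℝ → ℂ, Continuous f → (∀ x, f (x + L) = f x) → ∃ K, ∀ x, ‖f x‖ ≤ K := by
    intro f hf hp
    have hp' : Function.Periodic (fun x => ‖f x‖) L := fun x => by simp only [hp]
    obtain ⟨K, hK⟩ := (hp'.compact_of_continuous hL.ne' hf.norm).isBounded.bddAbove
    exact ⟨K, fun x => hK ⟨x, rfl⟩⟩
  have hp1 : ∀ x, deriv u (x + L) = deriv u x := fun x => by
    rw [← deriv_comp_add_const]; simp only [hper]
  have hp2 : ∀ x, deriv (deriv u) (x + L) = deriv (deriv u) x := fun x => by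
    rw [← deriv_comp_add_const]; simp only [hp1]
  have hc1 : ContDiff ℝ 1 (deriv u) := hu.iterate_deriv' 1 1
  obtain ⟨K0, h0⟩ := key u hu.continuous hper
  obtain ⟨K1, h1⟩ := key (deriv u) hc1.continuous hp1
  obtain ⟨K2, h2⟩ := key (deriv (deriv u)) (hc1.continuous_deriv (by norm_num)) hp2
  refine ⟨1 + |K0| + |K1| + |K2|, ?_, fun x => (h0 x).trans ?_, fun x => (h1 x).trans ?_,
    fun x => (h2 x).trans ?_⟩ <;>
  linarith [abs_nonneg K0, abs_nonneg K1, abs_nonneg K2, le_abs_self K0, le_abs_self K1,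
    le_abs_self K2]

/-- Asymptotics of `α` in nontangential sectors: the sign is governed by whether the multiplier and
the spectral parameter make the first or the second component of the solution dominant. -/
lemma alpha_asymptotics (hu : ContDiff ℝ 2 u) (hper : ∀ x, u (x + L) = u x) (hL : 0 < L)
    {δ : ℝ} (hδ : 0 < δ) : ∃ R C : ℝ, ∀ z, R ≤ ‖z‖ → δ * ‖z‖ ≤ |z.im| →
      z ∉ laxSpectrum u ∧ z ∉ dirichletSpectrum u L ∧ ∀ m, m ^ 2 - 2 * Delta u L z * m + 1 = 0 →
      ((‖m‖ < 1 ∧ 0 < z.im ∨ 1 < ‖m‖ ∧ z.im < 0) →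
        ‖alpha u L m z - 2 * Complex.I * z ^ 2‖ ≤ C * ‖1 / z‖) ∧
      ((‖m‖ < 1 ∧ z.im < 0 ∨ 1 < ‖m‖ ∧ 0 < z.im) →
        ‖alpha u L m z + 2 * Complex.I * z ^ 2‖ ≤ C * ‖1 / z‖) := by
  have hc := hu.continuous
  obtain ⟨K, hK, b0, b1, b2⟩ := exists_C2_periodic_bound hu hper hL
  have hp1 : ∀ x, deriv u (x + L) = deriv u x := fun x => by
    rw [← deriv_comp_add_const]; simp only [hper]
  have d0 : ∀ x, HasDerivAt u (deriv u x) x := fun x =>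
    (hu.differentiable (by norm_num) x).hasDerivAt
  have d1 : ∀ x, HasDerivAt (deriv u) (deriv (deriv u) x) x := fun x =>
    (hu.differentiable_deriv_two x).hasDerivAt
  -- The Riccati bound for `|κ| = 2|z|` and `|Re κ| = 2|Im z| ≥ 2δ|z|` is `C₁ / |z|³`.
  set C₁ := (K + 4 * K ^ 3) / (4 * δ) with hC₁
  have hC₁p : 0 < C₁ := by positivity
  -- The threshold `2K/δ` forces `|Im z| ≥ 2K`; the other terms keep the ratio `p` below `1/2`, so
  -- that `1 + p` is safely invertible.
  refine ⟨2 * K / δ + 4 * K + 4 * C₁ + 1,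
    2 * (2 * K ^ 3 + K ^ 2 + C₁ * (4 + 2 * K + 2 * K ^ 2)), fun z hR hsec => ?_⟩
  have hq : 0 < 2 * K / δ := by positivity
  have hz1 : 1 ≤ ‖z‖ := by linarith
  have hzp : 0 < ‖z‖ := by linarith
  have hz0 : z ≠ 0 := norm_pos_iff.1 hzp
  have him : 2 * K ≤ |z.im| := by
    refine le_trans ?_ hsec
    have : 2 * K / δ ≤ ‖z‖ := by linarith
    rw [div_le_iff₀ hδ] at this
    linarith
  have him' : K < |z.im| := by linarith
  have hdir := not_mem_dirichletSpectrum_of_lt_abs_im hc hL b0 him'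
  refine ⟨not_mem_laxSpectrum_of_lt_abs_im hc hper hL b0 him', hdir, fun m hm => ?_⟩
  have hb : Yt u z L 0 1 ≠ 0 := fun h => hdir ((mem_dirichletSpectrum_iff hc hL).2 h)
  obtain ⟨w, hw⟩ := exists_eigenvector hc hm (Or.inl hb)
  obtain ⟨hbf, hψ⟩ := bfDefined_and_psi_eq hc hper (Or.inl hb) hw
  have hψw : psi u L m z 0 1 = w := by rw [hψ]; simp [Yt_zero hc]
  obtain ⟨hsol, hmul, -⟩ := (isBlochFloquet_iff hc hper).2 ⟨w, rfl, hw⟩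
  have hv := isModifiedSolution_iff.1 hsol
  set v : ℝ → Fin 2 → ℂ := fun x => U⁻¹ *ᵥ (Yt u z x *ᵥ ![1, w]) with hvdef
  have hvm : ∀ x, v (x + L) = m • v x := fun x => by
    simp only [hvdef, hmul x, mulVec_smul]
  have hs2 : ((Real.sqrt 2 : ℝ) : ℂ) ≠ 0 := by simp
  have hv0 : v 0 = ((Real.sqrt 2 : ℝ) : ℂ)⁻¹ • ![1 + Complex.I * w, 1 - Complex.I * w] := by
    simp only [hvdef, Yt_zero hc, one_mulVec, U_inv_mulVec]; simp
  have hv00 : v 0 0 = ((Real.sqrt 2 : ℝ) : ℂ)⁻¹ * (1 + Complex.I * w) := by rw [hv0]; simp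
  have hv01 : v 0 1 = ((Real.sqrt 2 : ℝ) : ℂ)⁻¹ * (1 - Complex.I * w) := by rw [hv0]; simp
  have hvne : v 0 ≠ 0 := by
    intro h
    have e0 := congrFun h 0
    have e1 := congrFun h 1
    rw [hv00] at e0
    rw [hv01] at e1
    have e2 : ((Real.sqrt 2 : ℝ) : ℂ)⁻¹ * 2 = 0 := by
      simp only [Pi.zero_apply] at e0 e1
      linear_combination e0 + e1
    simp at e2
  have hmono := hv.strictMono_energy hc b0 him' hvne
  have hm0 : m ≠ 0 := by rintro rfl; simp at hm
  have henergy : ∀ x, z.im * (‖v x 0‖ ^ 2 - ‖v x 1‖ ^ 2) <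
      ‖m‖ ^ 2 * (z.im * (‖v x 0‖ ^ 2 - ‖v x 1‖ ^ 2)) := by
    intro x
    have := hmono (lt_add_of_pos_right x hL)
    simp only [hvm, Pi.smul_apply, smul_eq_mul, norm_mul] at this
    linarith
  -- Over one period the energy is multiplied by `‖m‖²` and yet increases, so it is negative here,
  -- and positive for `‖m‖ > 1`.
  have hsmall : ‖m‖ < 1 → ∀ x, z.im * (‖v x 0‖ ^ 2 - ‖v x 1‖ ^ 2) < 0 := by
    intro h x
    have h1 : ‖m‖ ^ 2 < 1 := pow_lt_one₀ (norm_nonneg _) h two_ne_zero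
    by_contra! hcon
    nlinarith [henergy x]
  have hlarge : 1 < ‖m‖ → ∀ x, 0 < z.im * (‖v x 0‖ ^ 2 - ‖v x 1‖ ^ 2) := by
    intro h x
    have h1 : 1 < ‖m‖ ^ 2 := one_lt_pow₀ h two_ne_zero
    by_contra! hcon
    nlinarith [henergy x]
  have hderiv : ∀ x, HasDerivAt (fun x => v x 0) (-Complex.I * z * v x 0 + u x * v x 1) x ∧
      HasDerivAt (fun x => v x 1)
        (-(starRingEnd ℂ) (u x) * v x 0 + Complex.I * z * v x 1) x := by
    intro x
    have h := hasDerivAt_pi.1 (hv x)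
    rw [X_mulVec] at h
    exact ⟨h 0, h 1⟩
  have hC₂ : 2 * (K + 4 * K ^ 3) / ((2 * ‖z‖) ^ 2 * (2 * |z.im|)) ≤ C₁ / ‖z‖ ^ 3 := by
    have him0 : 0 < |z.im| := by linarith
    rw [hC₁, div_div, div_le_div_iff₀ (by positivity) (by positivity)]
    have : (2 * ‖z‖) ^ 2 * (2 * (δ * ‖z‖)) ≤ (2 * ‖z‖) ^ 2 * (2 * |z.im|) := by gcongr
    have hp : 0 ≤ K + 4 * K ^ 3 := by positivity
    nlinarith [mul_le_mul_of_nonneg_left this hp]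
  have hnear : ∀ (p a a' d : ℂ), ‖a‖ ≤ K → ‖a'‖ ≤ K → ‖d‖ ≤ C₁ / ‖z‖ ^ 3 →
      p = a / (2 * Complex.I * z) + a' / (4 * z ^ 2) + d → ‖p‖ ≤ 1 / 2 := by
    rintro p a a' d ha ha' hd rfl
    have e1 : ‖a / (2 * Complex.I * z)‖ ≤ 1 / 8 := by
      rw [norm_div, norm_mul, norm_mul, Complex.norm_I, Complex.norm_ofNat, mul_one,
        div_le_iff₀ (by positivity)]
      linarith
    have e2 : ‖a' / (4 * z ^ 2)‖ ≤ 1 / 8 := by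
      rw [norm_div, norm_mul, norm_pow, Complex.norm_ofNat, div_le_iff₀ (by positivity)]
      nlinarith
    have e3 : C₁ / ‖z‖ ^ 3 ≤ 1 / 4 := by
      rw [div_le_iff₀ (by positivity)]
      have : ‖z‖ ≤ ‖z‖ ^ 3 := le_self_pow₀ hz1 (by norm_num)
      linarith
    refine (norm_add_le _ _).trans ?_
    linarith [norm_add_le (a / (2 * Complex.I * z)) (a' / (4 * z ^ 2))]
  have hconj : ∀ x, ‖(starRingEnd ℂ) (u x)‖ ≤ K := fun x => by rw [RCLike.norm_conj]; exact b0 x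
  have hconj1 : ∀ x, ‖(starRingEnd ℂ) (deriv u x)‖ ≤ K := fun x => by
    rw [RCLike.norm_conj]; exact b1 x
  have hprod : ‖u 0 * (starRingEnd ℂ) (u 0)‖ ≤ K ^ 2 := by
    rw [norm_mul, sq]; gcongr
    · exact b0 0
    · exact hconj 0
  have hKK : K ≤ K ^ 2 := le_self_pow₀ hK (by norm_num)
  have h3 : ((‖u 0‖ : ℝ) : ℂ) ^ 2 = u 0 * (starRingEnd ℂ) (u 0) := by rw [Complex.mul_conj']
  have hfinal : 2 * (2 * K ^ 3 + K ^ 2 + C₁ * (4 + 2 * K + 2 * K ^ 2)) * ‖1 / z‖ =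
      2 * ((2 * K ^ 3 + K ^ 2 + C₁ * (4 + 2 * K + 2 * K ^ 2)) / ‖z‖) := by
    rw [norm_div, norm_one]; ring
  constructor
  · intro hcase
    have hlt : ∀ x, ‖v x 0‖ < ‖v x 1‖ := by
      intro x
      refine lt_of_pow_lt_pow_left₀ 2 (norm_nonneg _) ?_
      rcases hcase with ⟨h1, h2⟩ | ⟨h1, h2⟩
      · have := hsmall h1 x; nlinarith
      · have := hlarge h1 x; nlinarith
    have hne : ∀ x, v x 1 ≠ 0 := fun x => norm_pos_iff.1 ((norm_nonneg _).trans_lt (hlt x))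
    have hric := riccati_periodic_bound hL (f := fun x => v x 0 / v x 1) (a := u) (a' := deriv u)
      (a'' := deriv (deriv u)) (b := fun x => (starRingEnd ℂ) (u x)) (κ := -2 * Complex.I * z) hK
      (fun x => ?_) d0 d1 (fun x => ?_) hper hp1 (fun x => ?_) b0 b1 b2 hconj ?_ 0
    · set d := v 0 0 / v 0 1 + u 0 / (-2 * Complex.I * z) + deriv u 0 / (-2 * Complex.I * z) ^ 2
        with hd
      have hdb : ‖d‖ ≤ C₁ / ‖z‖ ^ 3 := by
        refine hric.trans (le_of_eq_of_le ?_ hC₂)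
        simp [abs_mul]
      have hp : v 0 0 / v 0 1 = u 0 / (2 * Complex.I * z) + deriv u 0 / (4 * z ^ 2) + d := by
        have : (-2 * Complex.I * z) ^ 2 = -(4 * z ^ 2) := by ring_nf; simp
        rw [hd, this, show -2 * Complex.I * z = -(2 * Complex.I * z) by ring, div_neg, div_neg]
        ring
      have hpb := hnear _ _ _ _ (b0 0) (b1 0) hdb hp
      have hpw : (1 + v 0 0 / v 0 1) * w = Complex.I * (1 - v 0 0 / v 0 1) := by
        have hne0 := hne 0
        field_simp
        rw [hv00, hv01]
        ring_nf
        simp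
      rw [hfinal]
      refine norm_le_of_one_add_mul_eq hpb (norm_remainder_le (x := u 0) (x' := deriv u 0)
        (c := -(starRingEnd ℂ) (u 0))
        (y := Complex.I * ((starRingEnd ℂ) (deriv u 0) + u 0 * (starRingEnd ℂ) (u 0)))
        (k := -4 * Complex.I) hK hz1 (b0 0) (b1 0) (by rw [norm_neg]; exact hconj 0) ?_ (by simp)
        hdb) ?_
      · rw [norm_mul, Complex.norm_I, one_mul]
        exact (norm_add_le _ _).trans (by linarith [hconj1 0])
      · rw [alpha, hψw, h3]
        exact one_add_mul_alpha_sub hz0 hp hpw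
    · have hne0 := hne x
      refine ((hderiv x).1.fun_div (hderiv x).2 hne0).congr_deriv ?_
      field_simp
      ring
    · simp only [hvm, Pi.smul_apply, smul_eq_mul]
      exact mul_div_mul_left _ _ hm0
    · rw [norm_div]
      exact div_le_one_of_le₀ (hlt x).le (norm_nonneg _)
    · simpa [abs_mul] using (by linarith : 4 * K ≤ 2 * |z.im|)
  · intro hcase
    have hlt : ∀ x, ‖v x 1‖ < ‖v x 0‖ := by
      intro x
      refine lt_of_pow_lt_pow_left₀ 2 (norm_nonneg _) ?_
      rcases hcase with ⟨h1, h2⟩ | ⟨h1, h2⟩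
      · have := hsmall h1 x; nlinarith
      · have := hlarge h1 x; nlinarith
    have hne : ∀ x, v x 0 ≠ 0 := fun x => norm_pos_iff.1 ((norm_nonneg _).trans_lt (hlt x))
    have hric := riccati_periodic_bound hL (f := fun x => v x 1 / v x 0)
      (a := fun x => -(starRingEnd ℂ) (u x)) (a' := fun x => -(starRingEnd ℂ) (deriv u x))
      (a'' := fun x => -(starRingEnd ℂ) (deriv (deriv u) x)) (b := fun x => -u x)
      (κ := 2 * Complex.I * z) hK
      (fun x => ?_) (fun x => (hasDerivAt_conj (d0 x)).neg) (fun x => (hasDerivAt_conj (d1 x)).neg)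
      (fun x => ?_) (fun x => by simp only [hper]) (fun x => by simp only [hp1]) (fun x => ?_)
      (fun x => by rw [norm_neg]; exact hconj x) (fun x => by rw [norm_neg]; exact hconj1 x)
      (fun x => by rw [norm_neg, RCLike.norm_conj]; exact b2 x)
      (fun x => by rw [norm_neg]; exact b0 x) ?_ 0
    · set d := v 0 1 / v 0 0 + -(starRingEnd ℂ) (u 0) / (2 * Complex.I * z)
        + -(starRingEnd ℂ) (deriv u 0) / (2 * Complex.I * z) ^ 2 with hd
      have hdb : ‖d‖ ≤ C₁ / ‖z‖ ^ 3 := by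
        refine hric.trans (le_of_eq_of_le ?_ hC₂)
        simp [abs_mul]
      have hp : v 0 1 / v 0 0 = (starRingEnd ℂ) (u 0) / (2 * Complex.I * z) +
          -(starRingEnd ℂ) (deriv u 0) / (4 * z ^ 2) + d := by
        have : (2 * Complex.I * z) ^ 2 = -(4 * z ^ 2) := by ring_nf; simp
        rw [hd, this]
        ring
      have hpb := hnear _ _ _ _ (hconj 0) (by rw [norm_neg]; exact hconj1 0) hdb hp
      have hpw : (1 + v 0 1 / v 0 0) * w = Complex.I * (v 0 1 / v 0 0 - 1) := by
        have hne0 := hne 0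
        field_simp
        rw [hv00, hv01]
        ring_nf
        simp
      rw [hfinal]
      refine norm_le_of_one_add_mul_eq hpb (norm_remainder_le (x := (starRingEnd ℂ) (u 0))
        (x' := -(starRingEnd ℂ) (deriv u 0)) (c := u 0)
        (y := Complex.I * (deriv u 0 - u 0 * (starRingEnd ℂ) (u 0)))
        (k := 4 * Complex.I) hK hz1 (hconj 0) (by rw [norm_neg]; exact hconj1 0) (b0 0) ?_ (by simp)
        hdb) ?_
      · rw [norm_mul, Complex.norm_I, one_mul]
        exact (norm_sub_le _ _).trans (by linarith [b1 0])
      · rw [alpha, hψw, h3]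
        exact one_add_mul_alpha_add hz0 hp hpw
    · have hne0 := hne x
      refine ((hderiv x).2.fun_div (hderiv x).1 hne0).congr_deriv ?_
      field_simp
      ring
    · simp only [hvm, Pi.smul_apply, smul_eq_mul]
      exact mul_div_mul_left _ _ hm0
    · rw [norm_div]
      exact div_le_one_of_le₀ (hlt x).le (norm_nonneg _)
    · simpa [abs_mul] using (by linarith : 4 * K ≤ 2 * |z.im|)

end Asymptotics

/-! ### Poles of `α` and motion of Dirichlet eigenvalues -/

section Poles

open Matrix

/-- Differentiability of a continuous zero branch of a function with a nondegenerate first-order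
expansion. -/
lemma hasDerivWithinAt_of_zero_branch {f : ℂ → ℝ → ℂ} {I : Set ℝ} {t : ℝ} {μ : ℝ → ℂ} {a b : ℂ}
    (ha : a ≠ 0) (hf : (fun p : ℂ × ℝ => f p.1 p.2 - f (μ t) t - ((p.1 - μ t) * a +
      ((p.2 - t : ℝ) : ℂ) * b)) =o[𝓝[Set.univ ×ˢ I] (μ t, t)] fun p => p - (μ t, t))
    (hμ : ContinuousWithinAt μ I t) (ht : t ∈ I) (hzero : ∀ s ∈ I, f (μ s) s = 0) :
    HasDerivWithinAt μ (-b / a) I t := by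
  have htend : Tendsto (fun s : ℝ => (μ s, s)) (𝓝[I] t) (𝓝[Set.univ ×ˢ I] (μ t, t)) :=
    tendsto_nhdsWithin_iff.2 ⟨hμ.prodMk_nhds (tendsto_nhdsWithin_of_tendsto_nhds tendsto_id),
      eventually_mem_nhdsWithin.mono fun s hs => ⟨trivial, hs⟩⟩
  have h1 := hf.comp_tendsto htend
  have h2 : (fun s : ℝ => μ s - μ t - (s - t) • (-b / a)) =o[𝓝[I] t]
      fun s : ℝ => (μ s - μ t, s - t) := by
    refine (h1.const_mul_left (-1 / a)).congr' ?_ (.of_forall fun s => rfl)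
    filter_upwards [self_mem_nhdsWithin] with s hs
    simp only [Function.comp_apply, hzero s hs, hzero t ht, Complex.real_smul]
    field_simp
    ring
  rw [hasDerivWithinAt_iff_isLittleO]
  refine h2.trans_isBigO ?_
  -- The error is still relative to `(μ s - μ t, s - t)`. Absorbing half of it gives `μ s - μ t =
  -- O(s - t)`, after which it is `o(s - t)`.
  have h3 := isLittleO_iff.1 h2 (c := 1 / 2) (by norm_num)
  refine IsBigO.of_bound (2 + 2 * ‖-b / a‖) ?_
  filter_upwards [h3] with s hs
  have h4 : ‖((μ s - μ t, s - t) : ℂ × ℝ)‖ ≤ ‖μ s - μ t‖ + ‖s - t‖ := by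
    rw [Prod.norm_def]
    exact max_le_add_of_nonneg (norm_nonneg _) (norm_nonneg _)
  have h5 : ‖μ s - μ t‖ ≤ ‖μ s - μ t - (s - t) • (-b / a)‖ + ‖s - t‖ * ‖-b / a‖ := by
    rw [← norm_smul]
    simpa using norm_add_le (μ s - μ t - (s - t) • (-b / a)) ((s - t) • (-b / a))
  nlinarith

/-- At a simple zero of `y` the quotient `(z - μ)/y` is the inverse slope, which tends to `1/y'`. A
nonzero limit of `(z - μ) F` means order zero there, hence order `-1` for `F`. -/
lemma hasSimplePole_of_eventuallyEq {F B₀ B₁ n y : ℂ → ℂ} {μ : ℂ} (hB₀ : AnalyticAt ℂ B₀ μ)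
    (hB₁ : AnalyticAt ℂ B₁ μ) (hn : AnalyticAt ℂ n μ) (hy : AnalyticAt ℂ y μ) (hy0 : y μ = 0)
    (hy' : deriv y μ ≠ 0) (hF : ∀ᶠ z in 𝓝[≠] μ, F z = B₀ z + B₁ z * (n z / y z)) :
    HasSimplePole F μ (B₁ μ * (n μ / deriv y μ)) := by
  have hmer : MeromorphicAt F μ := by
    refine MeromorphicAt.congr (hB₀.meromorphicAt.add (hB₁.meromorphicAt.mul
      (hn.meromorphicAt.div hy.meromorphicAt))) ?_
    filter_upwards [hF] with z hz
    simp [hz]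
  have hlim : Tendsto (fun z => (z - μ) * F z) (𝓝[≠] μ) (𝓝 (B₁ μ * (n μ / deriv y μ))) := by
    have hslope := hasDerivAt_iff_tendsto_slope.1 hy.differentiableAt.hasDerivAt
    have h1 : Tendsto (fun z => (z - μ) * B₀ z + B₁ z * (n z / slope y μ z)) (𝓝[≠] μ)
        (𝓝 ((μ - μ) * B₀ μ + B₁ μ * (n μ / deriv y μ))) := by
      have hc : ∀ {f : ℂ → ℂ}, ContinuousAt f μ → Tendsto f (𝓝[≠] μ) (𝓝 (f μ)) :=
        fun h => h.tendsto.mono_left nhdsWithin_le_nhds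
      have hid : Tendsto (fun z : ℂ => z - μ) (𝓝[≠] μ) (𝓝 (μ - μ)) :=
        hc (f := fun z => z - μ) (by fun_prop)
      exact (hid.mul (hc hB₀.continuousAt)).add
        ((hc hB₁.continuousAt).mul ((hc hn.continuousAt).div hslope hy'))
    rw [sub_self, zero_mul, zero_add] at h1
    refine h1.congr' ?_
    filter_upwards [hF, self_mem_nhdsWithin] with z hz hzμ
    rw [hz, slope_def_field, hy0, sub_zero, mul_add, div_div_eq_mul_div]
    ring
  refine ⟨hmer, hlim, fun hr => ?_⟩
  have hid : MeromorphicAt (fun z : ℂ => z - μ) μ := by fun_prop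
  have h0 := (tendsto_ne_zero_iff_meromorphicOrderAt_eq_zero (hid.mul hmer)).1 ⟨_, hr, hlim⟩
  rw [meromorphicOrderAt_mul hid hmer] at h0
  have h1 : meromorphicOrderAt (fun z : ℂ => z - μ) μ = 1 := by simp
  rw [h1] at h0
  cases h : meromorphicOrderAt F μ with
  | top => simp [h] at h0
  | coe n =>
    rw [h] at h0
    have h2 : (1 + n : ℤ) = 0 := by exact_mod_cast h0
    have h3 : n = -1 := by omega
    rw [h3]; rfl

/-- Analytic continuation of a root `m` of `m² - 2 D m + 1` at a point where it is simple. -/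
lemma exists_analyticAt_root {D : ℂ → ℂ} {μ m : ℂ} (hD : AnalyticAt ℂ D μ)
    (hm : m ^ 2 - 2 * D μ * m + 1 = 0) (hm1 : m ^ 2 ≠ 1) :
    ∃ r : ℂ → ℂ, AnalyticAt ℂ r μ ∧ r μ = m ∧ ∀ᶠ z in 𝓝 μ, r z ^ 2 - 2 * D z * r z + 1 = 0 := by
  set s := m - D μ with hs
  have hs2 : s ^ 2 = D μ ^ 2 - 1 := by rw [hs]; linear_combination hm
  have hs0 : s ≠ 0 := by
    intro h0
    have e1 : m = D μ := by linear_combination h0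
    rw [← e1] at hm
    exact hm1 (by linear_combination -hm)
  -- Dividing the discriminant by its value at `μ` moves it to `1`, where the principal logarithm is
  -- analytic and yields a square root.
  have hw : AnalyticAt ℂ (fun z => (D z ^ 2 - 1) / s ^ 2) μ :=
    ((hD.pow 2).sub analyticAt_const).div analyticAt_const (pow_ne_zero 2 hs0)
  have hw1 : (D μ ^ 2 - 1) / s ^ 2 = 1 := by rw [← hs2]; exact div_self (pow_ne_zero 2 hs0)
  have hlog : AnalyticAt ℂ (fun z => Complex.log ((D z ^ 2 - 1) / s ^ 2)) μ :=
    hw.clog (by rw [hw1]; exact Complex.one_mem_slitPlane)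
  refine ⟨fun z => D z + s * Complex.exp (Complex.log ((D z ^ 2 - 1) / s ^ 2) / 2),
    hD.add (analyticAt_const.mul (hlog.div_const).cexp), ?_, ?_⟩
  · simp only [hw1, Complex.log_one, zero_div, Complex.exp_zero, mul_one]
    rw [hs, add_sub_cancel]
  · filter_upwards [hw.continuousAt.eventually_ne (y := 0) (by rw [hw1]; exact one_ne_zero)]
      with z hz
    have h1 : Complex.exp (Complex.log ((D z ^ 2 - 1) / s ^ 2) / 2) ^ 2 =
        (D z ^ 2 - 1) / s ^ 2 := by
      rw [← Complex.exp_nat_mul]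
      rw [show ((2 : ℕ) : ℂ) * (Complex.log ((D z ^ 2 - 1) / s ^ 2) / 2) =
        Complex.log ((D z ^ 2 - 1) / s ^ 2) by push_cast; ring, Complex.exp_log hz]
    have h2 : s ^ 2 * ((D z ^ 2 - 1) / s ^ 2) = D z ^ 2 - 1 := by field_simp
    linear_combination s ^ 2 * h1 + h2

lemma root_eq_or_mul_eq_one {D r m : ℂ} (hr : r ^ 2 - 2 * D * r + 1 = 0)
    (hm : m ^ 2 - 2 * D * m + 1 = 0) : m = r ∨ m * r = 1 := by
  have : (m - r) * (m * r - 1) = 0 := by linear_combination r * hm - m * hr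
  rcases mul_eq_zero.1 this with h | h
  · exact Or.inl (sub_eq_zero.1 h)
  · exact Or.inr (sub_eq_zero.1 h)

lemma inv_root {D m : ℂ} (hm : m ^ 2 - 2 * D * m + 1 = 0) :
    m ≠ 0 ∧ m⁻¹ ^ 2 - 2 * D * m⁻¹ + 1 = 0 := by
  have hm0 : m ≠ 0 := by rintro rfl; simp at hm
  refine ⟨hm0, ?_⟩
  field_simp
  linear_combination hm

lemma alpha_eq_of_ne_zero {u : ℝ → ℂ} (hu : Continuous u) {L : ℝ} (hper : ∀ x, u (x + L) = u x)
    {m z : ℂ} (hm : m ^ 2 - 2 * Delta u L z * m + 1 = 0) (hb : Yt u z L 0 1 ≠ 0) :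
    alpha u L m z = modTimeMatrix u z 0 0 0 +
      modTimeMatrix u z 0 0 1 * ((m - Yt u z L 0 0) / Yt u z L 0 1) := by
  obtain ⟨w, hw⟩ := exists_eigenvector hu hm (Or.inl hb)
  have hψ := (bfDefined_and_psi_eq hu hper (Or.inl hb) hw).2
  have h1 := (mulVec_one_eq_smul_iff.1 hw).1
  rw [alpha_eq, hψ]
  simp only [Yt_zero hu, one_mulVec]
  congr 2
  rw [eq_div_iff hb, show (![1, w] : Fin 2 → ℂ) 1 = w from rfl]
  linear_combination h1

lemma differentiable_modTimeMatrix (u : ℝ → ℂ) (x : ℝ) (i j : Fin 2) :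
    Differentiable ℂ fun z => modTimeMatrix u z x i j := by
  fin_cases i <;> fin_cases j <;> simp [modTimeMatrix, U_conj, timeMatrix] <;> fun_prop

/-- At a Dirichlet eigenvalue the monodromy matrix is triangular, so its last diagonal entry is `ρ`
or `ρ⁻¹`, and `ν` tells which. The value `ν = 0` absorbs the branch case `ρ = ±1`, where no analytic
continuation of `ρ` is available. -/
lemma nu_eq_one_or_neg_one {u : ℝ → ℂ} (hu : Continuous u) {L : ℝ} {ρ : ℂ → ℂ} {μ : ℂ}
    (hρ : ρ μ ^ 2 - 2 * Delta u L μ * ρ μ + 1 = 0) (hρ1 : μ ∉ laxSpectrum u → ‖ρ μ‖ < 1)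
    (hμ : Yt u μ L 0 1 = 0) :
    (nu u L ρ μ = 1 → Yt u μ L 1 1 = ρ μ ∧ ρ μ ^ 2 ≠ 1) ∧
    (nu u L ρ μ = -1 → Yt u μ L 1 1 = (ρ μ)⁻¹ ∧ ρ μ ^ 2 ≠ 1) := by
  have hc := charpoly_Yt hu hρ
  have hdet := det_Yt hu μ L
  have htr : Yt u μ L 0 0 + Yt u μ L 1 1 = 2 * Delta u L μ := by
    rw [Delta, ← trace_Yt, trace_fin_two]; ring
  obtain ⟨hρ0, -⟩ := inv_root hρ
  rw [det_fin_two, hμ, zero_mul, sub_zero] at hdet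
  rw [hμ, zero_mul] at hc
  have hcase : Yt u μ L 1 1 = ρ μ ∨ Yt u μ L 1 1 = (ρ μ)⁻¹ := by
    rcases mul_eq_zero.1 hc with h | h
    · right
      rw [sub_eq_zero.1 h]
      exact eq_inv_of_mul_eq_one_right hdet
    · left; exact (sub_eq_zero.1 h).symm
  by_cases hs : μ ∈ laxSpectrum u \ mainSpectrum u L
  · have hne : ρ μ ^ 2 ≠ 1 := by
      intro h1
      refine hs.2 ?_
      have h2 : Delta u L μ * ρ μ = 1 := by linear_combination (h1 - hρ) / 2
      change Delta u L μ ^ 2 - 1 = 0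
      linear_combination (-Delta u L μ ^ 2) * h1 + (Delta u L μ * ρ μ + 1) * h2
    rw [nu, if_pos hs]
    split_ifs with h
    · exact ⟨fun _ => ⟨h, hne⟩, fun h' => by norm_num at h'⟩
    · exact ⟨fun h' => by norm_num at h', fun _ => ⟨hcase.resolve_left h, hne⟩⟩
  · rw [nu, if_neg hs]
    by_cases hlax : μ ∈ laxSpectrum u
    · have hmain : Delta u L μ ^ 2 - 1 = 0 := by
        by_contra hm
        exact hs ⟨hlax, hm⟩
      -- With `Δ² = 1` and determinant one the two diagonal entries coincide.
      have h1 : Yt u μ L 1 1 ^ 2 = 1 := by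
        have e1 : (Yt u μ L 0 0 - Yt u μ L 1 1) ^ 2 = 0 := by
          linear_combination (Yt u μ L 0 0 + Yt u μ L 1 1 + 2 * Delta u L μ) * htr
            + 4 * hmain - 4 * hdet
        have e2 : Yt u μ L 0 0 = Yt u μ L 1 1 := sub_eq_zero.1 (pow_eq_zero_iff two_ne_zero |>.1 e1)
        rw [e2] at hdet
        rw [sq, hdet]
      have h2 : ‖Yt u μ L 1 1‖ = 1 := by
        have := congrArg norm h1
        rw [norm_pow, norm_one] at this
        exact (pow_eq_one_iff_of_nonneg (norm_nonneg _) two_ne_zero).1 this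
      rw [h2, Real.log_one, Real.sign_zero, neg_zero]
      exact ⟨fun h => by norm_num at h, fun h => by norm_num at h⟩
    · have hlt := hρ1 hlax
      have hpos : 0 < ‖ρ μ‖ := norm_pos_iff.2 hρ0
      have hne : ρ μ ^ 2 ≠ 1 := by
        intro h
        have := congrArg norm h
        rw [norm_pow, norm_one] at this
        have := (pow_eq_one_iff_of_nonneg (norm_nonneg _) two_ne_zero).1 this
        linarith
      rcases hcase with h | h
      · rw [h, Real.sign_of_neg (Real.log_neg hpos hlt)]
        exact ⟨fun _ => ⟨rfl, hne⟩, fun h => by norm_num at h⟩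
      · rw [h, norm_inv, Real.log_inv, Real.sign_of_pos (neg_pos.2 (Real.log_neg hpos hlt))]
        exact ⟨fun h => by norm_num at h, fun _ => ⟨rfl, hne⟩⟩

variable {L : ℝ} {I : Set ℝ} {q : ℝ → ℝ → ℂ}

lemma IsPeriodicNLSSolution.differentiable_Delta (hI : I.OrdConnected)
    (hq : IsPeriodicNLSSolution L I q) {t : ℝ} (ht : t ∈ I) :
    Differentiable ℂ fun z => Delta (fun y => q y t) L z := by
  have h0 := hq.differentiable_Yt hI ht L 0 0
  have h1 := hq.differentiable_Yt hI ht L 1 1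
  have h : (fun z => Delta (fun y => q y t) L z) = fun z =>
      (1 / 2 : ℂ) * (Yt (fun y => q y t) z L 0 0 + Yt (fun y => q y t) z L 1 1) :=
    funext fun z => by rw [Delta, ← trace_Yt, trace_fin_two]
  rw [h]
  fun_prop

/-- The multiplier continues analytically through a point where it is not `±1`. -/
lemma exists_analytic_multiplier {u : ℝ → ℂ} (hu : Continuous u)
    (hper : ∀ x, u (x + L) = u x) (hL : 0 < L) (hΔ : Differentiable ℂ fun z => Delta u L z)
    {ρ : ℂ → ℂ} (hρ : IsFloquetMultiplier u L ρ) {μ : ℂ} (hμ : ρ μ ^ 2 ≠ 1) :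
    ∃ r : ℂ → ℂ, AnalyticAt ℂ r μ ∧ r μ = ρ μ ∧ (μ ∉ laxSpectrum u → ∀ᶠ z in 𝓝 μ, ρ z = r z) ∧
      ∀ D : Set ℂ, ContinuousWithinAt ρ D μ → ∀ᶠ z in 𝓝[D] μ, ρ z = r z := by
  obtain ⟨r, hr, hrμ, hroot⟩ := exists_analyticAt_root (hΔ.analyticAt μ) (hρ.1 μ) hμ
  refine ⟨r, hr, hrμ, fun hlax => ?_, fun D hD => ?_⟩
  · have h1 : ∀ᶠ z in 𝓝 μ, ‖r z‖ < 1 :=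
      hr.continuousAt.norm.eventually_lt_const (by simpa only [hrμ] using hρ.2 μ hlax)
    filter_upwards [h1, hroot] with z hz hrz
    have hnot : z ∉ laxSpectrum u := by
      rw [mem_laxSpectrum_iff hu hper hL]
      rintro ⟨m, hm1, hm⟩
      rcases root_eq_or_mul_eq_one hrz hm with h | h
      · rw [← h] at hz; linarith
      · have := congrArg norm h
        rw [norm_mul, hm1, norm_one] at this
        linarith
    refine (root_eq_or_mul_eq_one hrz (hρ.1 z)).resolve_right fun h => ?_
    have h2 := congrArg norm h
    rw [norm_mul, norm_one] at h2
    have := hρ.2 z hnot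
    nlinarith [norm_nonneg (ρ z), norm_nonneg (r z)]
  · have h1 : Tendsto (fun z => ρ z * r z) (𝓝[D] μ) (𝓝 (ρ μ * ρ μ)) := by
      have := hD.tendsto.mul (hr.continuousAt.continuousWithinAt (s := D)).tendsto
      rwa [hrμ] at this
    have h2 := h1.eventually_ne (show ρ μ * ρ μ ≠ 1 by rwa [← sq])
    filter_upwards [h2, hroot.filter_mono nhdsWithin_le_nhds] with z hz hrz
    exact (root_eq_or_mul_eq_one hrz (hρ.1 z)).resolve_right hz

/-- `σ` is `ρ` or `ρ⁻¹` and `s` its analytic continuation. The function `G` is the quotient formula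
for `α` with `s` in place of `σ`, so `α` agrees with it wherever `σ = s` and `Yt L 0 1` is nonzero.
-/
lemma IsPeriodicNLSSolution.hasSimplePoleSided_alpha (hI : I.OrdConnected)
    (hq : IsPeriodicNLSSolution L I q) {t : ℝ} (ht : t ∈ I) {S : Set ℂ} {ρ σ s : ℂ → ℂ} {μ : ℂ}
    (hσ : ∀ z, σ z ^ 2 - 2 * Delta (fun y => q y t) L z * σ z + 1 = 0)
    (hs : AnalyticAt ℂ s μ) (hsS : μ ∉ S → ∀ᶠ z in 𝓝 μ, σ z = s z)
    (hsD : ∀ D : Set ℂ, ContinuousWithinAt ρ D μ → ∀ᶠ z in 𝓝[D] μ, σ z = s z)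
    (hμ : Yt (fun y => q y t) μ L 0 1 = 0)
    (hμ' : deriv (fun z => Yt (fun y => q y t) z L 0 1) μ ≠ 0) :
    HasSimplePoleSided S ρ (fun z => alpha (fun y => q y t) L (σ z) z) μ
      (modTimeMatrix (fun y => q y t) μ 0 0 1 * ((s μ - Yt (fun y => q y t) μ L 0 0) /
        deriv (fun z => Yt (fun y => q y t) z L 0 1) μ)) := by
  have hu := hq.continuous_slice ht
  have hper := hq.periodic t ht
  have hB := fun i j => (differentiable_modTimeMatrix (fun y => q y t) 0 i j).analyticAt μ
  have hY := fun i j => (hq.differentiable_Yt hI ht L i j).analyticAt μ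
  have hne : ∀ᶠ z in 𝓝[≠] μ, Yt (fun y => q y t) z L 0 1 ≠ 0 := by
    have := (hY 0 1).differentiableAt.hasDerivAt.eventually_ne (c := 0) hμ'
    exact this
  have hpole : ∀ F : ℂ → ℂ, (∀ᶠ z in 𝓝[≠] μ, F z = modTimeMatrix (fun y => q y t) z 0 0 0 +
      modTimeMatrix (fun y => q y t) z 0 0 1 * ((s z - Yt (fun y => q y t) z L 0 0) /
        Yt (fun y => q y t) z L 0 1)) → HasSimplePole F μ _ := fun F hF =>
    hasSimplePole_of_eventuallyEq (hB 0 0) (hB 0 1) (hs.sub (hY 0 0)) (hY 0 1) hμ hμ' hF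
  refine ⟨fun hS => hpole _ ?_, fun _ => ⟨_, hpole _ (.of_forall fun _ => rfl), fun D hD => ?_⟩⟩
  · filter_upwards [hne, (hsS hS).filter_mono nhdsWithin_le_nhds] with z hz hsz
    rw [alpha_eq_of_ne_zero hu hper (hσ z) hz, hsz]
  · filter_upwards [hne.filter_mono (nhdsWithin_mono μ fun z hz => hz.2),
      (hsD D hD).filter_mono (nhdsWithin_mono μ Set.sdiff_subset)] with z hz hsz
    rw [alpha_eq_of_ne_zero hu hper (hσ z) hz, hsz]

/-- Motion of a simple Dirichlet eigenvalue. -/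
lemma IsPeriodicNLSSolution.hasDerivWithinAt_dirichlet (hI : I.OrdConnected)
    (hq : IsPeriodicNLSSolution L I q) {μ : ℝ → ℂ} (hμ : ContinuousOn μ I)
    (hzero : ∀ s ∈ I, Yt (fun y => q y s) (μ s) L 0 1 = 0) {t : ℝ} (ht : t ∈ I)
    (hμ' : deriv (fun z => Yt (fun y => q y t) z L 0 1) (μ t) ≠ 0) :
    HasDerivWithinAt μ (-(modTimeMatrix (fun y => q y t) (μ t) 0 0 1 *
      ((Yt (fun y => q y t) (μ t) L 1 1 - Yt (fun y => q y t) (μ t) L 0 0) /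
        deriv (fun z => Yt (fun y => q y t) z L 0 1) (μ t)))) I t := by
  obtain ⟨W, hW, ho⟩ := hq.exists_isLittleO_Yt hI ht (μ t) L (Pi.single 1 1)
  have hW0 : deriv (fun z => Yt (fun y => q y t) z L 0 1) (μ t) = W 0 := by
    have := hasDerivAt_pi.1 hW 0
    simp only [mulVec_single_one] at this
    exact this.deriv
  rw [modTimeMatrix_period (hq.periodic t ht)] at ho
  have hp := (ContinuousLinearMap.proj (R := ℂ) (φ := fun _ : Fin 2 => ℂ) 0).isBigO_comp
    _ _ |>.trans_isLittleO ho
  -- Since `M₁₂ = 0` at the eigenvalue, the corresponding entry of `[B, M]` is `B₁₂ (M₂₂ - M₁₁)`.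
  have hbr := hasDerivWithinAt_of_zero_branch (f := fun z s => Yt (fun y => q y s) z L 0 1)
    (b := modTimeMatrix (fun y => q y t) (μ t) 0 0 1 *
      (Yt (fun y => q y t) (μ t) L 1 1 - Yt (fun y => q y t) (μ t) L 0 0)) (hW0 ▸ hμ')
    (hp.congr_left fun p => ?_) (hμ t ht) ht hzero
  · refine hbr.congr_deriv ?_
    rw [hW0]; ring
  · have hz := hzero t ht
    simp only [ContinuousLinearMap.proj_apply, Pi.sub_apply, Pi.add_apply, Pi.smul_apply,
      mulVec_single_one, smul_eq_mul, mulVec, dotProduct, Fin.sum_univ_two, col_apply, hz]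
    ring

end Poles

end ZS

/-! ### Assembly of the evolution, the asymptotics and the poles -/

theorem proposition5p2 (L : ℝ) (hL : 0 < L) (I : Set ℝ) (hI : I.OrdConnected) (hI' : I.Nontrivial)
    (q : ℝ → ℝ → ℂ) (hq : ZS.IsPeriodicNLSSolution L I q)
    (t₀ : ℝ) (ht₀ : t₀ ∈ I) (ρ : ℂ → ℂ)
    (hρ : ZS.IsFloquetMultiplier (fun x => q x t₀) L ρ) :
    -- off the Dirichlet spectrum both normalized Bloch–Floquet solutions are uniquely determined
    (∀ t ∈ I, ∀ z, z ∉ ZS.dirichletSpectrum (fun x => q x t) L →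
      ZS.BFDefined (fun x => q x t) L (ρ z) z ∧ ZS.BFDefined (fun x => q x t) L (ρ z)⁻¹ z) ∧
    -- the evolution equation, wherever the solution is uniquely determined
    (∀ t ∈ I, ∀ z, ∀ m, m = ρ z ∨ m = (ρ z)⁻¹ → ZS.BFDefined (fun x => q x t) L m z → ∀ x,
      HasDerivWithinAt (fun s => ZS.psi (fun y => q y s) L m z x)
        (ZS.opAt (fun y => q y t) (ZS.psi (fun y => q y t) L m z) x
          - ZS.alpha (fun y => q y t) L m z • ZS.psi (fun y => q y t) L m z x) I t) ∧
    -- the asymptotics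
    (∀ t ∈ I, ∀ δ > 0,
      ((∀ᶠ z in Bornology.cobounded ℂ ⊓ 𝓟 (ZS.upperSector δ ∪ ZS.lowerSector δ),
          z ∉ ZS.dirichletSpectrum (fun x => q x t) L) ∧
        (fun z => ZS.alpha (fun x => q x t) L (ρ z) z - 2 * Complex.I * z ^ 2)
          =O[Bornology.cobounded ℂ ⊓ 𝓟 (ZS.upperSector δ)] (fun z => 1 / z) ∧
        (fun z => ZS.alpha (fun x => q x t) L (ρ z)⁻¹ z + 2 * Complex.I * z ^ 2)
          =O[Bornology.cobounded ℂ ⊓ 𝓟 (ZS.upperSector δ)] (fun z => 1 / z) ∧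
        (fun z => ZS.alpha (fun x => q x t) L (ρ z) z + 2 * Complex.I * z ^ 2)
          =O[Bornology.cobounded ℂ ⊓ 𝓟 (ZS.lowerSector δ)] (fun z => 1 / z) ∧
        (fun z => ZS.alpha (fun x => q x t) L (ρ z)⁻¹ z - 2 * Complex.I * z ^ 2)
          =O[Bornology.cobounded ℂ ⊓ 𝓟 (ZS.lowerSector δ)] (fun z => 1 / z))) ∧
    -- the poles, along a continuous branch of Dirichlet eigenvalues
    (∀ μ : ℝ → ℂ, ContinuousOn μ I →
      (∀ t ∈ I, μ t ∈ ZS.dirichletSpectrum (fun x => q x t) L) →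
      ∀ t ∈ I, deriv (fun z => ZS.Yt (fun x => q x t) z L 0 1) (μ t) ≠ 0 →
        (ZS.nu (fun x => q x t) L ρ (μ t) = 1 → ∃ μ' : ℂ, HasDerivWithinAt μ μ' I t ∧
          ZS.HasSimplePoleSided (ZS.laxSpectrum (fun x => q x t)) ρ
            (fun z => ZS.alpha (fun x => q x t) L (ρ z) z) (μ t) (-μ')) ∧
        (ZS.nu (fun x => q x t) L ρ (μ t) = -1 → ∃ μ' : ℂ, HasDerivWithinAt μ μ' I t ∧
          ZS.HasSimplePoleSided (ZS.laxSpectrum (fun x => q x t)) ρ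
            (fun z => ZS.alpha (fun x => q x t) L (ρ z)⁻¹ z) (μ t) (-μ'))) := by
  have hroot : ∀ t ∈ I, ∀ z, ρ z ^ 2 - 2 * ZS.Delta (fun x => q x t) L z * ρ z + 1 = 0 :=
    fun t ht z => by rw [hq.Delta_eq hI ht ht₀]; exact hρ.1 z
  have hroot' : ∀ t ∈ I, ∀ z, ∀ m, m = ρ z ∨ m = (ρ z)⁻¹ →
      m ^ 2 - 2 * ZS.Delta (fun x => q x t) L z * m + 1 = 0 := by
    rintro t ht z m (rfl | rfl)
    · exact hroot t ht z
    · exact (ZS.inv_root (hroot t ht z)).2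
  -- The modulus condition is given only at `t₀`; since `Δ` is conserved, so is the Lax spectrum.
  have hlax : ∀ t ∈ I, ∀ z, z ∉ ZS.laxSpectrum (fun x => q x t) → ‖ρ z‖ < 1 := by
    intro t ht z hz
    refine hρ.2 z fun h => hz ?_
    rw [ZS.mem_laxSpectrum_iff (hq.continuous_slice ht₀) (hq.periodic t₀ ht₀) hL] at h
    rw [ZS.mem_laxSpectrum_iff (hq.continuous_slice ht) (hq.periodic t ht) hL,
      hq.Delta_eq hI ht ht₀]
    exact h
  refine ⟨fun t ht z hz => ?_, fun t ht z m hm hbf x => ?_, fun t ht δ hδ => ?_,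
    fun μ hμ hdir t ht hsimple => ?_⟩
  · have hu := hq.continuous_slice ht
    have hb : ZS.Yt (fun x => q x t) z L 0 1 ≠ 0 := fun h =>
      hz ((ZS.mem_dirichletSpectrum_iff hu hL).2 h)
    have key : ∀ m, m = ρ z ∨ m = (ρ z)⁻¹ → ZS.BFDefined (fun x => q x t) L m z := by
      intro m hm
      obtain ⟨w, hw⟩ := ZS.exists_eigenvector hu (hroot' t ht z m hm) (Or.inl hb)
      exact (ZS.bfDefined_and_psi_eq hu (hq.periodic t ht) (Or.inl hb) hw).1
    exact ⟨key _ (Or.inl rfl), key _ (Or.inr rfl)⟩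
  · exact hq.hasDerivWithinAt_psi hI ht (hroot' t ht z m hm) hbf x
  · obtain ⟨R, C, hRC⟩ := ZS.alpha_asymptotics (hq.contDiff t ht) (hq.periodic t ht) hL hδ
    have hlarge : ∀ᶠ z : ℂ in Bornology.cobounded ℂ, max R 1 ≤ ‖z‖ :=
      tendsto_norm_cobounded_atTop.eventually_ge_atTop _
    have hup : ∀ᶠ z in Bornology.cobounded ℂ ⊓ 𝓟 (ZS.upperSector δ),
        R ≤ ‖z‖ ∧ δ * ‖z‖ ≤ |z.im| ∧ 0 < z.im := by
      filter_upwards [hlarge.filter_mono inf_le_left,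
        (eventually_principal.2 fun z hz => hz : ∀ᶠ z in 𝓟 (ZS.upperSector δ),
          z ∈ ZS.upperSector δ).filter_mono inf_le_right] with z hz hzs
      have h1 : 1 ≤ ‖z‖ := (le_max_right _ _).trans hz
      have h2 : δ * ‖z‖ ≤ z.im := hzs
      have h3 : 0 < z.im := lt_of_lt_of_le (by positivity) h2
      exact ⟨(le_max_left _ _).trans hz, h2.trans (le_abs_self _), h3⟩
    have hlow : ∀ᶠ z in Bornology.cobounded ℂ ⊓ 𝓟 (ZS.lowerSector δ),
        R ≤ ‖z‖ ∧ δ * ‖z‖ ≤ |z.im| ∧ z.im < 0 := by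
      filter_upwards [hlarge.filter_mono inf_le_left,
        (eventually_principal.2 fun z hz => hz : ∀ᶠ z in 𝓟 (ZS.lowerSector δ),
          z ∈ ZS.lowerSector δ).filter_mono inf_le_right] with z hz hzs
      have h1 : 1 ≤ ‖z‖ := (le_max_right _ _).trans hz
      have h2 : z.im ≤ -(δ * ‖z‖) := hzs
      have h3 : 0 < δ * ‖z‖ := by positivity
      exact ⟨(le_max_left _ _).trans hz, by linarith [neg_abs_le z.im], by linarith⟩
    have hsmall : ∀ z, R ≤ ‖z‖ → δ * ‖z‖ ≤ |z.im| → ‖ρ z‖ < 1 := fun z h1 h2 =>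
      hlax t ht z (hRC z h1 h2).1
    have hbig : ∀ z, R ≤ ‖z‖ → δ * ‖z‖ ≤ |z.im| → 1 < ‖(ρ z)⁻¹‖ := fun z h1 h2 => by
      rw [norm_inv]
      exact (one_lt_inv₀ (norm_pos_iff.2 (ZS.inv_root (hroot t ht z)).1)).2 (hsmall z h1 h2)
    refine ⟨?_, IsBigO.of_bound C ?_, IsBigO.of_bound C ?_, IsBigO.of_bound C ?_,
      IsBigO.of_bound C ?_⟩
    · rw [← sup_principal, inf_sup_left, eventually_sup]
      exact ⟨hup.mono fun z hz => (hRC z hz.1 hz.2.1).2.1,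
        hlow.mono fun z hz => (hRC z hz.1 hz.2.1).2.1⟩
    · exact hup.mono fun z ⟨h1, h2, h3⟩ =>
        ((hRC z h1 h2).2.2 _ (hroot' t ht z _ (Or.inl rfl))).1 (Or.inl ⟨hsmall z h1 h2, h3⟩)
    · exact hup.mono fun z ⟨h1, h2, h3⟩ =>
        ((hRC z h1 h2).2.2 _ (hroot' t ht z _ (Or.inr rfl))).2 (Or.inr ⟨hbig z h1 h2, h3⟩)
    · exact hlow.mono fun z ⟨h1, h2, h3⟩ =>
        ((hRC z h1 h2).2.2 _ (hroot' t ht z _ (Or.inl rfl))).2 (Or.inl ⟨hsmall z h1 h2, h3⟩)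
    · exact hlow.mono fun z ⟨h1, h2, h3⟩ =>
        ((hRC z h1 h2).2.2 _ (hroot' t ht z _ (Or.inr rfl))).1 (Or.inr ⟨hbig z h1 h2, h3⟩)
  · have hu := hq.continuous_slice ht
    have hzero : ∀ s ∈ I, ZS.Yt (fun x => q x s) (μ s) L 0 1 = 0 := fun s hs =>
      (ZS.mem_dirichletSpectrum_iff (hq.continuous_slice hs) hL).1 (hdir s hs)
    have hmove := hq.hasDerivWithinAt_dirichlet hI hμ hzero ht hsimple
    obtain ⟨hplus, hminus⟩ := ZS.nu_eq_one_or_neg_one hu (hroot t ht (μ t)) (hlax t ht (μ t))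
      (hzero t ht)
    have hmult := fun h : ρ (μ t) ^ 2 ≠ 1 => ZS.exists_analytic_multiplier hu (hq.periodic t ht) hL
      (hq.differentiable_Delta hI ht) ⟨hroot t ht, hlax t ht⟩ h
    constructor
    · intro hν
      obtain ⟨h22, hne⟩ := hplus hν
      obtain ⟨r, hr, hrμ, hoff, hon⟩ := hmult hne
      refine ⟨_, hmove, ?_⟩
      -- With `M₂₂ = ρ` the negative eigenvalue velocity is literally the residue of `α⁺`.
      rw [neg_neg, h22, ← hrμ]
      exact hq.hasSimplePoleSided_alpha hI ht (hroot t ht) hr hoff hon (hzero t ht) hsimple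
    · intro hν
      obtain ⟨h22, hne⟩ := hminus hν
      obtain ⟨r, hr, hrμ, hoff, hon⟩ := hmult hne
      have hr0 : r (μ t) ≠ 0 := by rw [hrμ]; exact (ZS.inv_root (hroot t ht (μ t))).1
      refine ⟨_, hmove, ?_⟩
      rw [neg_neg, h22, ← hrμ]
      exact hq.hasSimplePoleSided_alpha hI ht (σ := fun z => (ρ z)⁻¹) (s := fun z => (r z)⁻¹)
        (fun z => (ZS.inv_root (hroot t ht z)).2) (hr.inv hr0)
        (fun h => (hoff h).mono fun z hz => congrArg (·⁻¹) hz)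
        (fun D hD => (hon D hD).mono fun z hz => congrArg (·⁻¹) hz) (hzero t ht) hsimple
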